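/- Let $k$ be a field of characteristic $0$. An \emph{nc--$\mathfrak K$--modular operad} $\mathcal O$ in graded $k$--vector spaces consists of graded vector spaces $\mathcal O(\gamma,S)$ for all $\gamma\in\mathbb Z$ and all finite sets $S$, functorial in bijections of $S$, together with a composition $$\circ_{ord,\Gamma}:\ \bigotimes_{v}\mathcal O(\gamma(v),\mathrm{Flags}(v))\to\mathcal O(\gamma(\Gamma),S),\qquad \gamma(\Gamma)=1-\chi(\Gamma)+\sum_v\gamma(v),\quad \chi(\Gamma)=|\{\text{vertices}\}|-|\{\text{edges}\}|,$$ for every non-empty, not necessarily connected, finite graph $\Gamma$ with vertices labelled by integers $\gamma(v)$, with tails labelled bijectively by $S$, and with an order $ord$ of its edges. Every edge is an odd symbol of degree $w$, where $w\in\{1,-1\}$ is fixed ($w=-1$ is the twist by $\mathfrak K(\Gamma)=\mathrm{Det}(\mathrm{Edge}(\Gamma))$): $\circ_{ord,\Gamma}$ has degree $w\,|\{\text{edges}\}|$ and changes by the sign of the permutation when the edges are reordered. The compositions are equivariant under isomorphisms of graphs, the corolla acts as the identity, and they are associative under the insertion of graphs into vertices, all with Koszul signs (the edges of the outer graph come first,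 followed by those of the inserted graphs). Write $a\boxminus b\in\mathcal O(\gamma+\gamma'-1,S\amalg T)$ for the composition of $a\in\mathcal O(\gamma,S)$ and $b\in\mathcal O(\gamma',T)$ along the graph with two vertices and no edge, $\circ_{st}(a\otimes b)\in \mathcal O(\gamma+\gamma',(S\setminus s)\amalg(T\setminus t))$ for the composition along the graph with two vertices and one edge $\{s,t\}$, and $\circ_{ss'}(a)\in\mathcal O(\gamma+1,S\setminus\{s,s'\})$ for the composition along the graph with one vertex and one loop $\{s,s'\}$. Let $\mathcal O^\oplus_{\mathbb S}=\bigoplus_{\gamma,n}\mathcal O(\gamma,\{0,\dots,n-1\})_{\mathbb S_n}$ be the full coinvariants and $\mathcal O^\oplus_{C}=\bigoplus_{\gamma,n}\mathcal O(\gamma,\{0,\dots,n-1\})_{C_n}$ the cyclic ones, where $C_n\subset\mathbb S_n$ is generated by the long cycle. Write $[a]$ for the class of $a$, and $|a|$ for its degree. Then the sum over non-self gluings $$\{[a]\odot[b]\}=(-1)^{|a|}\sum_{s\in S,\,t\in T}[\circ_{st}(a\otimes b)]$$ is a well-defined odd Lie bracket of degree $w$ on $\mathcal O^\oplus_{\mathbb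 S}$ and on $\mathcal O^\oplus_{C}$; in the cyclic case $(S\setminus s)\amalg(T\setminus t)$ is enumerated in the cyclic order $s+1,\dots,s-1,t+1,\dots,t-1$. That is, $\{x\odot y\}=-(-1)^{(|x|+1)(|y|+1)}\{y\odot x\}$, and the Jacobi identity holds with the signs of the degrees $|\cdot|+1$. On $\mathcal O^\oplus_{\mathbb S}$ the multiplication $[a][b]=[a\boxminus b]$ is well defined and the bracket $\{\,\odot\,\}$ is Gerstenhaber for it: the multiplication is associative of degree $0$ and $$\{x\odot yz\}=\{x\odot y\}z+(-1)^{(|x|-1)|y|}\,y\{x\odot z\}.$$ The sum over self-gluings $\Delta[a]=\sum_{\{s,s'\}\subset S,\ s\ne s'}[\circ_{ss'}(a)]$ is well defined on $\mathcal O^\oplus_{\mathbb S}$ and is a BV operator of degree $w$ for this multiplication: the multiplication is associative and supercommutative, $\Delta^2=0$, and the bracket $(-1)^{|x|}\Delta(xy)-x\Delta(y)-(-1)^{|x|}\Delta(x)y$ induced by $\Delta$ is Gerstenhaber. Moreover this induced bracket equals $\{x\odot y\}$. -/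

import Mathlib

open scoped DirectSum

universe u v

/-! ### Koszul signs -/

/-- The Koszul sign of the rearrangement `σ` of a family of symbols of degrees `d`: one factor
`(-1) ^ (d x * d y)` for every pair `x < y` whose order is reversed by `σ`. -/
def koszulSign {V V' : Type} [Fintype V] [LinearOrder V] [LinearOrder V']
    (σ : V ≃ V') (d : V → ℤ) : ℤˣ :=
  ∏ p : V × V, if p.1 < p.2 ∧ σ p.2 < σ p.1 then (d p.1 * d p.2).negOnePow else 1

/-- The Koszul sign of `(e₁ a₁) (e₂ a₂) ⋯ ⟶ (e₁ e₂ ⋯) (a₁ a₂ ⋯)`, where `aᵥ` has degree `d v` and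
`eᵥ` has degree `e v`: every `e v'` moves past every `a v` with `v < v'`. -/
def shuffleSign {V : Type} [Fintype V] [LinearOrder V] (d e : V → ℤ) : ℤˣ :=
  ∏ p : V × V, if p.1 < p.2 then (d p.1 * e p.2).negOnePow else 1

/-! ### Graphs -/

/-- A (not necessarily connected) graph whose set of vertices is `V`, whose set of flags (half
edges) at the vertex `v` is `L v`, whose set of edges is `E`, and whose tails are labelled
bijectively by `S`.  So the set of all flags is `Σ v, L v`; a flag is either the tail with some
label `s : S`, or one of the two halves `(e, false)`, `(e, true)` of some edge `e : E`. -/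
structure NCGraph {V : Type} (L : V → Type) (E S : Type) where
  flags : (Σ v, L v) ≃ S ⊕ (E × Bool)

namespace NCGraph

variable {V : Type} {L : V → Type} {E S : Type}

/-- The involution on flags that exchanges the two halves of every edge and fixes the tails. -/
def invol (Γ : NCGraph L E S) (f : Σ v, L v) : Σ v, L v :=
  Γ.flags.symm (Sum.map id (Prod.map id not) (Γ.flags f))

/-- The Euler characteristic `|vertices| - |edges|`. -/
def eulerChar [Fintype V] [Fintype E] (_ : NCGraph L E S) : ℤ :=
  (Fintype.card V : ℤ) - Fintype.card E

/-- The total label `γ(Γ) = 1 - χ(Γ) + ∑ γ(v)` of a graph whose vertices are labelled by `γ`. -/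
def totalGamma [Fintype V] [Fintype E] (Γ : NCGraph L E S) (γ : V → ℤ) : ℤ :=
  1 - Γ.eulerChar + ∑ v, γ v

/-- An isomorphism of graphs over a bijection `τ` of the labels of the tails: bijections on
vertices, on flags and on edges, compatible with all the structure.  The two halves of an edge may
be interchanged. -/
structure Iso {V' : Type} {L' : V' → Type} {E' S' : Type}
    (Γ : NCGraph L E S) (Γ' : NCGraph L' E' S') (τ : S ≃ S') where
  onV : V ≃ V'
  onL : ∀ v, L v ≃ L' (onV v)
  onE : E ≃ E'
  tail : ∀ v x s, Γ.flags ⟨v, x⟩ = Sum.inl s → Γ'.flags ⟨onV v, onL v x⟩ = Sum.inl (τ s)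
  edge : ∀ v x e b, Γ.flags ⟨v, x⟩ = Sum.inr (e, b) →
    ∃ b', Γ'.flags ⟨onV v, onL v x⟩ = Sum.inr (onE e, b')

/-- The corolla: one vertex, no edges, the flags are the tails. -/
def corolla (S : Type) : NCGraph (fun _ : Unit => S) (Fin 0) S where
  flags := (Equiv.uniqueSigma fun _ : Unit => S).trans (Equiv.sumEmpty S (Fin 0 × Bool)).symm

/-- Insertion of a graph `Δ v` into every vertex `v` of `Γ`; the tails of `Δ v` are labelled by the
flags of `Γ` at `v`.  The edges are those of `Γ` followed by those of the `Δ v`. -/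
def subst {W : V → Type} {M : ∀ v, W v → Type} {F : V → Type}
    (Γ : NCGraph L E S) (Δ : ∀ v, NCGraph (M v) (F v) (L v)) :
    NCGraph (V := Σₗ v, W v) (fun p => M (ofLex p).1 (ofLex p).2) (E ⊕ₗ (Σₗ v, F v)) S where
  flags :=
    calc (Σ p : (Σₗ v, W v), M (ofLex p).1 (ofLex p).2)
      _ ≃ (Σ p : (Σ v, W v), M p.1 p.2) :=
          Equiv.sigmaCongr ofLex fun _ => Equiv.refl _
      _ ≃ (Σ v, Σ w, M v w) := Equiv.sigmaAssoc M
      _ ≃ (Σ v, L v ⊕ (F v × Bool)) := Equiv.sigmaCongrRight fun v => (Δ v).flags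
      _ ≃ (Σ v, L v) ⊕ (Σ v, F v × Bool) := Equiv.sigmaSumDistrib _ _
      _ ≃ (S ⊕ (E × Bool)) ⊕ ((Σ v, F v) × Bool) :=
          Equiv.sumCongr Γ.flags (Equiv.sigmaProdDistrib F Bool).symm
      _ ≃ S ⊕ ((E × Bool) ⊕ ((Σ v, F v) × Bool)) := Equiv.sumAssoc _ _ _
      _ ≃ S ⊕ ((E ⊕ (Σ v, F v)) × Bool) :=
          Equiv.sumCongr (Equiv.refl S) (Equiv.sumProdDistrib E (Σ v, F v) Bool).symm
      _ ≃ S ⊕ ((E ⊕ₗ (Σₗ v, F v)) × Bool) :=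
          Equiv.sumCongr (Equiv.refl S)
            (Equiv.prodCongr ((Equiv.sumCongr (Equiv.refl E) toLex).trans toLex) (Equiv.refl Bool))

/-- The flags of a graph with two vertices, `S` at the first and `T` at the second one. -/
abbrev pair (S T : Type) : Bool → Type := fun b => bif b then T else S

instance pair_finite (S T : Type) [Finite S] [Finite T] (b : Bool) : Finite (pair S T b) := by
  cases b <;> simpa [pair]

/-- Two vertices and no edge. -/
def merger (S T : Type) : NCGraph (pair S T) (Fin 0) (S ⊕ T) where
  flags := (Equiv.sumEquivSigmaBool S T).symm.trans (Equiv.sumEmpty (S ⊕ T) (Fin 0 × Bool)).symm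

open Classical in
/-- Two vertices and one edge, formed by the flag `s` at the first and the flag `t` at the second
vertex. -/
noncomputable def bridge {S T : Type} (s : S) (t : T) :
    NCGraph (pair S T) Unit ({x : S // x ≠ s} ⊕ {y : T // y ≠ t}) where
  flags := (Equiv.sumEquivSigmaBool S T).symm.trans
    { toFun := Sum.elim
        (fun x => if h : x = s then Sum.inr ((), false) else Sum.inl (Sum.inl ⟨x, h⟩))
        (fun y => if h : y = t then Sum.inr ((), true) else Sum.inl (Sum.inr ⟨y, h⟩))
      invFun := Sum.elim (Sum.map Subtype.val Subtype.val)
        (fun p => if p.2 then Sum.inr t else Sum.inl s)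
      left_inv := by
        rintro (x | y)
        · by_cases h : x = s <;> simp [h]
        · by_cases h : y = t <;> simp [h]
      right_inv := by
        rintro ((⟨x, h⟩ | ⟨y, h⟩) | ⟨⟨⟩, b⟩)
        · simp [h]
        · simp [h]
        · cases b <;> simp }

open Classical in
/-- One vertex and one edge, formed by the two distinct flags `s` and `s'`. -/
noncomputable def loop {S : Type} (s s' : S) (hs : s ≠ s') :
    NCGraph (fun _ : Unit => S) Unit {x : S // x ≠ s ∧ x ≠ s'} where
  flags := (Equiv.uniqueSigma fun _ : Unit => S).trans
    { toFun := fun x => if h : x = s then Sum.inr ((), false) else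
        if h' : x = s' then Sum.inr ((), true) else Sum.inl ⟨x, h, h'⟩
      invFun := Sum.elim Subtype.val (fun p => if p.2 then s' else s)
      left_inv := by
        intro x
        by_cases h : x = s
        · simp [h]
        · by_cases h' : x = s'
          · subst h'; simp [h]
          · simp [h, h']
      right_inv := by
        rintro (⟨x, h, h'⟩ | ⟨⟨⟩, b⟩)
        · simp [h, h']
        · cases b <;> simp [hs.symm] }

end NCGraph

/-! ### nc-`𝔎`-modular operads -/

/-- An nc-`𝔎`-modular operad in graded `k`-vector spaces: an algebra over the triple of not
necessarily connected graphs, twisted by `𝔎(Γ) = Det(Edge(Γ))`.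

* `obj S` is the direct sum of all `O(γ, S)`, and `gr S γ d` is the part of degree `d` of `O(γ, S)`.
* A basis element of `𝔎(Γ)` is an order of the edges of `Γ`.  For every graph with ordered edges,
  `comp Γ` is the composition `⨂ᵥ O(γ(v), Flags(v)) → O(γ(Γ), S)`; the tensor product is written
  in the order of the vertices.  Reordering vertices and edges gives Koszul signs.
* Every edge has degree `w`, which is `-1` for `𝔎` and `1` for `𝔎⁻¹`. -/
structure NCKModularOperad (k : Type u) [Field k] (w : ℤˣ) where
  obj (S : Type) [Finite S] : Type v
  [addCommGroup (S : Type) [Finite S] : AddCommGroup (obj S)]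
  [module (S : Type) [Finite S] : Module k (obj S)]
  gr (S : Type) [Finite S] (γ d : ℤ) : Submodule k (obj S)
  isInternal (S : Type) [Finite S] :
    DirectSum.IsInternal fun p : ℤ × ℤ => gr S p.1 p.2
  /-- the action of bijections -/
  map {S T : Type} [Finite S] [Finite T] (f : S ≃ T) : obj S →ₗ[k] obj T
  map_refl {S : Type} [Finite S] (a : obj S) : map (Equiv.refl S) a = a
  map_trans {S T U : Type} [Finite S] [Finite T] [Finite U] (f : S ≃ T) (g : T ≃ U) (a : obj S) :
    map (f.trans g) a = map g (map f a)
  map_mem {S T : Type} [Finite S] [Finite T] (f : S ≃ T) {γ d : ℤ} {a : obj S}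
    (ha : a ∈ gr S γ d) : map f a ∈ gr T γ d
  /-- the composition along a graph -/
  comp {V : Type} [Finite V] [LinearOrder V] [Nonempty V] {L : V → Type} [∀ v, Finite (L v)]
    {E : Type} [Finite E] [LinearOrder E] {S : Type} [Finite S] (Γ : NCGraph L E S) :
    MultilinearMap k (fun v => obj (L v)) (obj S)
  comp_mem {V : Type} [Fintype V] [LinearOrder V] [Nonempty V] {L : V → Type}
    [∀ v, Finite (L v)] {E : Type} [Fintype E] [LinearOrder E] {S : Type} [Finite S]
    (Γ : NCGraph L E S) (γ d : V → ℤ) (a : ∀ v, obj (L v)) (ha : ∀ v, a v ∈ gr (L v) (γ v) (d v)) :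
    comp Γ a ∈ gr S (Γ.totalGamma γ) (∑ v, d v + w * Fintype.card E)
  /-- equivariance -/
  comp_iso {V : Type} [Fintype V] [LinearOrder V] [Nonempty V] {L : V → Type}
    [∀ v, Finite (L v)] {E : Type} [Fintype E] [LinearOrder E] {S : Type} [Finite S]
    {V' : Type} [Finite V'] [LinearOrder V'] [Nonempty V'] {L' : V' → Type}
    [∀ v, Finite (L' v)] {E' : Type} [Finite E'] [LinearOrder E'] {S' : Type} [Finite S']
    (Γ : NCGraph L E S) (Γ' : NCGraph L' E' S') (τ : S ≃ S') (φ : Γ.Iso Γ' τ)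
    (γ d : V → ℤ) (a : ∀ v, obj (L v)) (ha : ∀ v, a v ∈ gr (L v) (γ v) (d v))
    (a' : ∀ v, obj (L' v)) (haa' : ∀ v, a' (φ.onV v) = map (φ.onL v) (a v)) :
    comp Γ' a' = (koszulSign φ.onV d * koszulSign φ.onE fun _ => 1) • map τ (comp Γ a)
  /-- unit -/
  comp_corolla {S : Type} [Finite S] (a : obj S) : comp (NCGraph.corolla S) (fun _ => a) = a
  /-- associativity -/
  comp_subst {V : Type} [Fintype V] [LinearOrder V] [Nonempty V] {L : V → Type}
    [∀ v, Finite (L v)] {E : Type} [Finite E] [LinearOrder E] {S : Type} [Finite S]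
    {W : V → Type} [∀ v, Fintype (W v)] [∀ v, LinearOrder (W v)] [∀ v, Nonempty (W v)]
    [Finite (Σₗ v, W v)] [Nonempty (Σₗ v, W v)]
    {M : ∀ v, W v → Type} [∀ v x, Finite (M v x)]
    {F : V → Type} [∀ v, Fintype (F v)] [∀ v, LinearOrder (F v)] [Finite (E ⊕ₗ (Σₗ v, F v))]
    (Γ : NCGraph L E S) (Δ : ∀ v, NCGraph (M v) (F v) (L v))
    (γ d : ∀ v, W v → ℤ) (a : ∀ v x, obj (M v x)) (ha : ∀ v x, a v x ∈ gr (M v x) (γ v x) (d v x)) :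
    comp Γ (fun v => comp (Δ v) (a v)) =
      shuffleSign (fun v => ∑ x, d v x) (fun v => (Fintype.card (F v) : ℤ)) •
        comp (Γ.subst Δ) (fun p => a (ofLex p).1 (ofLex p).2)

namespace NCKModularOperad

attribute [instance] addCommGroup module

variable {k : Type u} [Field k] {w : ℤˣ} (O : NCKModularOperad.{u, v} k w)

/-- A pair of elements as a decoration of a graph with two vertices. -/
def pairElt {S T : Type} [Finite S] [Finite T] (a : O.obj S) (b : O.obj T) :
    ∀ v : Bool, O.obj (NCGraph.pair S T v)
  | false => a
  | true => b

/-- The horizontal composition `a ⊟ b`. -/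
def hmul {S T : Type} [Finite S] [Finite T] (a : O.obj S) (b : O.obj T) : O.obj (S ⊕ T) :=
  O.comp (NCGraph.merger S T) (O.pairElt a b)

/-- The composition along the graph with two vertices and one edge that joins `s` and `t`. -/
noncomputable def glue {S T : Type} [Finite S] [Finite T] (s : S) (t : T)
    (a : O.obj S) (b : O.obj T) : O.obj ({x : S // x ≠ s} ⊕ {y : T // y ≠ t}) :=
  O.comp (NCGraph.bridge s t) (O.pairElt a b)

/-- The self-gluing of the flags `s` and `s'`. -/
noncomputable def selfGlue {S : Type} [Finite S] (s s' : S) (h : s ≠ s') (a : O.obj S) :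
    O.obj {x : S // x ≠ s ∧ x ≠ s'} :=
  O.comp (NCGraph.loop s s' h) (fun _ => a)

/-! ### Coinvariants -/

/-- The action of the symmetric group on `O(n) = ⨁ O(γ, {0, …, n - 1})`. -/
def rep (n : ℕ) : Representation k (Equiv.Perm (Fin n)) (O.obj (Fin n)) where
  toFun σ := O.map σ
  map_one' := LinearMap.ext fun a => O.map_refl a
  map_mul' σ τ := LinearMap.ext fun a => O.map_trans τ σ a

/-- The direct sum over `n` of the coinvariants of `O(n)` under the subgroup `H n` of the symmetric
group. -/
abbrev Coinv (H : ∀ n, Subgroup (Equiv.Perm (Fin n))) : Type v :=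
  ⨁ n, Representation.Coinvariants ((O.rep n).comp (H n).subtype)

/-- The class of an element of `O(n)`. -/
noncomputable def cls (H : ∀ n, Subgroup (Equiv.Perm (Fin n))) (n : ℕ) :
    O.obj (Fin n) →ₗ[k] O.Coinv H :=
  DirectSum.lof k ℕ (fun n => Representation.Coinvariants ((O.rep n).comp (H n).subtype)) n ∘ₗ
    Representation.Coinvariants.mk ((O.rep n).comp (H n).subtype)

/-- The part of degree `d` of the coinvariants. -/
noncomputable def degPart (H : ∀ n, Subgroup (Equiv.Perm (Fin n))) (d : ℤ) :
    Submodule k (O.Coinv H) :=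
  ⨆ (n : ℕ) (γ : ℤ), (O.gr (Fin n) γ d).map (O.cls H n)

/-- The full symmetric groups. -/
def fullGroups (n : ℕ) : Subgroup (Equiv.Perm (Fin n)) := ⊤

/-- The cyclic groups generated by the long cycles. -/
def cyclicGroups (n : ℕ) : Subgroup (Equiv.Perm (Fin n)) := Subgroup.zpowers (finRotate n)

/-- The full coinvariants. -/
abbrev FullCoinv : Type v := O.Coinv fullGroups

/-- The cyclic coinvariants. -/
abbrev CyclicCoinv : Type v := O.Coinv cyclicGroups

/-- The class in the full coinvariants of an element of `O(S)`, `S` any finite set.  It does not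
depend on the enumeration of `S`. -/
noncomputable def fullCls (S : Type) [Finite S] : O.obj S →ₗ[k] O.FullCoinv :=
  O.cls fullGroups (Nat.card S) ∘ₗ O.map (Finite.equivFin S)

end NCKModularOperad

/-- The enumeration `s + 1, s + 2, …, s - 1` of `{0, …, n - 1} ∖ {s}` in the cyclic order. -/
def cyclicEnum {n : ℕ} (s : Fin n) : {x : Fin n // x ≠ s} ≃ Fin (n - 1) where
  toFun x := ⟨(x.1.val + (n - 1 - s.val)) % n, by
    have h1 := x.1.isLt
    have h2 := s.isLt
    have h3 : x.1.val ≠ s.val := fun h => x.2 (Fin.ext h)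
    rcases lt_or_gt_of_ne h3 with h | h
    · rw [Nat.mod_eq_of_lt (by omega)]; omega
    · rw [Nat.mod_eq_sub_mod (by omega), Nat.mod_eq_of_lt (by omega)]; omega⟩
  invFun j := ⟨⟨(j.val + s.val + 1) % n, Nat.mod_lt _ s.pos⟩, by
    have h1 := j.isLt
    have h2 := s.isLt
    intro h
    have h3 : (j.val + s.val + 1) % n = s.val := congrArg Fin.val h
    by_cases h4 : j.val + s.val + 1 < n
    · rw [Nat.mod_eq_of_lt h4] at h3; omega
    · rw [Nat.mod_eq_sub_mod (by omega), Nat.mod_eq_of_lt (by omega)] at h3; omega⟩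
  left_inv x := by
    have h1 := x.1.isLt
    have h2 := s.isLt
    have h3 : x.1.val ≠ s.val := fun h => x.2 (Fin.ext h)
    apply Subtype.ext
    apply Fin.ext
    simp only
    rw [add_assoc, Nat.mod_add_mod,
      show x.1.val + (n - 1 - s.val) + (s.val + 1) = x.1.val + n by omega, Nat.add_mod_right,
      Nat.mod_eq_of_lt h1]
  right_inv j := by
    have h1 := j.isLt
    have h2 := s.isLt
    apply Fin.ext
    simp only
    rw [Nat.mod_add_mod, show j.val + s.val + 1 + (n - 1 - s.val) = j.val + n by omega,
      Nat.add_mod_right, Nat.mod_eq_of_lt (by omega)]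

/-- The enumeration of `({0, …, n - 1} ∖ {s}) ⨿ ({0, …, m - 1} ∖ {t})` in its cyclic order
`s + 1, …, s - 1, t + 1, …, t - 1`. -/
def cyclicSumEnum {n m : ℕ} (s : Fin n) (t : Fin m) :
    {x : Fin n // x ≠ s} ⊕ {y : Fin m // y ≠ t} ≃ Fin ((n - 1) + (m - 1)) :=
  (Equiv.sumCongr (cyclicEnum s) (cyclicEnum t)).trans finSumFinEquiv

/-! ### Graded algebras with an odd bracket or a BV operator

Here `𝒜 d` is the part of degree `d` of a graded vector space `A`. -/

section Algebras

variable {k : Type u} [Field k] {A : Type v} [AddCommGroup A] [Module k A]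

/-- An odd Lie bracket of degree `w`: odd anti-symmetry and the odd Jacobi identity, with the signs
of the shifted degrees. -/
structure IsOddLie (𝒜 : ℤ → Submodule k A) (w : ℤˣ) (br : A →ₗ[k] A →ₗ[k] A) : Prop where
  isInternal : DirectSum.IsInternal 𝒜
  degree : ∀ i j a b, a ∈ 𝒜 i → b ∈ 𝒜 j → br a b ∈ 𝒜 (i + j + w)
  antisymm : ∀ i j a b, a ∈ 𝒜 i → b ∈ 𝒜 j →
    br a b = -(((i + 1) * (j + 1)).negOnePow • br b a)
  jacobi : ∀ i j l a b c, a ∈ 𝒜 i → b ∈ 𝒜 j → c ∈ 𝒜 l →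
    br a (br b c)
      + ((l + 1) * ((i + 1) + (j + 1))).negOnePow • br c (br a b)
      + ((i + 1) * ((j + 1) + (l + 1))).negOnePow • br b (br c a) = 0

/-- A Gerstenhaber (odd Poisson) algebra: an odd Lie bracket and an associative multiplication of
degree `0` for which the bracket is an odd derivation. -/
structure IsGerstenhaber (𝒜 : ℤ → Submodule k A) (w : ℤˣ)
    (mul br : A →ₗ[k] A →ₗ[k] A) : Prop where
  oddLie : IsOddLie 𝒜 w br
  mul_degree : ∀ i j a b, a ∈ 𝒜 i → b ∈ 𝒜 j → mul a b ∈ 𝒜 (i + j)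
  mul_assoc : ∀ a b c, mul (mul a b) c = mul a (mul b c)
  leibniz : ∀ i j a b c, a ∈ 𝒜 i → b ∈ 𝒜 j →
    br a (mul b c) = mul (br a b) c + ((i - 1) * j).negOnePow • mul b (br a c)

/-- `br` is the bracket `{a, b} = (-1)^|a| D(ab) - a D(b) - (-1)^|a| D(a) b` induced by `D`. -/
def IsInducedBracket (𝒜 : ℤ → Submodule k A) (mul : A →ₗ[k] A →ₗ[k] A) (D : A →ₗ[k] A)
    (br : A →ₗ[k] A →ₗ[k] A) : Prop :=
  ∀ i a b, a ∈ 𝒜 i →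
    br a b = i.negOnePow • D (mul a b) - mul a (D b) - i.negOnePow • mul (D a) b

/-- A BV algebra: an associative supercommutative multiplication of degree `0` and a differential
`D` of degree `w` whose induced bracket is Gerstenhaber. -/
structure IsBV (𝒜 : ℤ → Submodule k A) (w : ℤˣ) (mul : A →ₗ[k] A →ₗ[k] A)
    (D : A →ₗ[k] A) : Prop where
  mul_degree : ∀ i j a b, a ∈ 𝒜 i → b ∈ 𝒜 j → mul a b ∈ 𝒜 (i + j)
  mul_assoc : ∀ a b c, mul (mul a b) c = mul a (mul b c)
  mul_comm : ∀ i j a b, a ∈ 𝒜 i → b ∈ 𝒜 j → mul a b = (i * j).negOnePow • mul b a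
  degree : ∀ i a, a ∈ 𝒜 i → D a ∈ 𝒜 (i + w)
  sq_zero : ∀ a, D (D a) = 0
  gerstenhaber : ∃ br : A →ₗ[k] A →ₗ[k] A,
    IsInducedBracket 𝒜 mul D br ∧ IsGerstenhaber 𝒜 w mul br

end Algebras

namespace NCKModularOperad

variable {k : Type u} [Field k] {w : ℤˣ} (O : NCKModularOperad.{u, v} k w)

/-! ### The operations on coinvariants

By the Koszul rule the odd symbol of the gluing in `{a ⊙ b}` stands between `a` and `b`, whence the
sign `(-1)^|a|` relative to `glue`, where it stands in front of both. -/

/-- `mul` is the multiplication `[a] [b] = [a ⊟ b]`. -/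
def IsHorizontalMul (mul : O.FullCoinv →ₗ[k] O.FullCoinv →ₗ[k] O.FullCoinv) : Prop :=
  ∀ (S T : Type) [Finite S] [Finite T] (a : O.obj S) (b : O.obj T),
    mul (O.fullCls S a) (O.fullCls T b) = O.fullCls (S ⊕ T) (O.hmul a b)

/-- `br` is the sum `{[a] ⊙ [b]}` over all the non-self gluings, on the full coinvariants. -/
def IsFullGluingBracket (br : O.FullCoinv →ₗ[k] O.FullCoinv →ₗ[k] O.FullCoinv) : Prop :=
  ∀ (S T : Type) [Fintype S] [Fintype T] (γ d : ℤ) (a : O.obj S) (b : O.obj T), a ∈ O.gr S γ d →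
    br (O.fullCls S a) (O.fullCls T b) =
      d.negOnePow • ∑ s : S, ∑ t : T, O.fullCls _ (O.glue s t a b)

/-- `br` is the sum `{[a] ⊙ [b]}` over all the non-self gluings, on the cyclic coinvariants.  The
flags of the result are enumerated in their cyclic order. -/
def IsCyclicGluingBracket (br : O.CyclicCoinv →ₗ[k] O.CyclicCoinv →ₗ[k] O.CyclicCoinv) : Prop :=
  ∀ (n m : ℕ) (γ d : ℤ) (a : O.obj (Fin n)) (b : O.obj (Fin m)), a ∈ O.gr (Fin n) γ d →
    br (O.cls cyclicGroups n a) (O.cls cyclicGroups m b) =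
      d.negOnePow • ∑ s : Fin n, ∑ t : Fin m,
        O.cls cyclicGroups _ (O.map (cyclicSumEnum s t) (O.glue s t a b))

/-- `D` is the sum `Δ` over all the self-gluings, one for every unordered pair of distinct flags. -/
def IsSelfGluingOperator (D : O.FullCoinv →ₗ[k] O.FullCoinv) : Prop :=
  ∀ (S : Type) [Fintype S] [LinearOrder S] (a : O.obj S),
    D (O.fullCls S a) =
      ∑ p : {p : S × S // p.1 < p.2}, O.fullCls _ (O.selfGlue p.1.1 p.1.2 p.2.ne a)

end NCKModularOperad

/-! Every gluing factors through two operations: horizontal composition `hmulₗ` and contraction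
`contr` of one pair of flags. A self-gluing is a contraction by definition, and `glue_eq` writes a
gluing of two elements as a contraction of their horizontal composition. Equivariance and
associativity of the operad become a short calculus: `hmul_comm` and `hmul_assoc`; `contr_contr`,
two contractions anticommute because their edges are odd; `hmul_contr_left` and `hmul_contr_right`,
an edge on the right factor moves past the left factor a at the cost of (-1)^|a|.

In the full coinvariants the class of a contraction depends only on the unordered pair of contracted
flags (`fullCls_contr`), so Δ is half the sum over ordered pairs. Then Δ² is a sum over pairs of
pairs that changes sign when the two are exchanged, hence vanishes. The pairs of flags of a ⊟ b lie
in a, lie in b, or are mixed; the first two kinds give the derivation terms of Δ(ab), so the bracket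
induced by Δ is exactly the sum over mixed pairs, the gluing bracket (`fullDelta_mul`,
`fullBracket_fullCls`). The Leibniz rule holds because an edge from a to b ⊟ c ends in b or in c.

The Jacobi identity is proved in the finer, cyclic setting. The term {a, {b, c}} is a sum over trees
with middle vertex b or c in which the edge between b and c is made first. Each tree occurs in
exactly two of the three Jacobi terms, with its two edges made in opposite orders, hence with
opposite signs; the two resulting enumerations of the free flags differ by a rotation
(`contr_contr_tree`, `glueSecond_eq`). The projection `cycToFull` is surjective in every degree and
respects the brackets, so the odd Lie axioms descend to the full coinvariants. -/

instance finite_lex (α : Type) [Finite α] : Finite (Lex α) := ‹Finite α›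

instance nonempty_lex (α : Type) [Nonempty α] : Nonempty (Lex α) := ‹Nonempty α›

instance nonempty_sigma_lex {ι : Type} (α : ι → Type) [Nonempty ι] [∀ i, Nonempty (α i)] :
    Nonempty (Σₗ i, α i) :=
  ⟨toLex ⟨Classical.arbitrary ι, Classical.arbitrary _⟩⟩

/-! ### Koszul signs of particular rearrangements -/

theorem koszulSign_eq_one_of_lt {V V' : Type} [Fintype V] [LinearOrder V] [LinearOrder V']
    (σ : V ≃ V') (d : V → ℤ) (h : ∀ x y, x < y → σ x < σ y) : koszulSign σ d = 1 := by
  refine Finset.prod_eq_one fun p _ => if_neg ?_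
  rintro ⟨h1, h2⟩
  exact lt_asymm (h _ _ h1) h2

theorem koszulSign_of_subsingleton {V V' : Type} [Fintype V] [LinearOrder V] [LinearOrder V']
    [Subsingleton V] (σ : V ≃ V') (d : V → ℤ) : koszulSign σ d = 1 :=
  koszulSign_eq_one_of_lt σ d fun x y h => absurd (Subsingleton.elim x y) h.ne

/-- The sign of the transposition of two symbols. -/
theorem koszulSign_swap {V V' : Type} [Fintype V] [LinearOrder V] [LinearOrder V']
    (σ : V ≃ V') (d : V → ℤ) (x y : V) (hxy : x < y) (hV : ∀ z, z = x ∨ z = y)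
    (h : σ y < σ x) : koszulSign σ d = (d x * d y).negOnePow := by
  unfold koszulSign
  rw [Finset.prod_eq_single (x, y)]
  · simp [hxy, h]
  · rintro ⟨p, q⟩ _ hpq
    refine if_neg ?_
    rintro ⟨h1, -⟩
    simp only at h1
    rcases hV p with rfl | rfl <;> rcases hV q with rfl | rfl
    · exact lt_irrefl _ h1
    · exact hpq rfl
    · exact lt_asymm h1 hxy
    · exact lt_irrefl _ h1
  · simp

/-- Edges only move to the left, past the decorations of earlier vertices, so edges inserted at the
first vertex cost no sign. -/
theorem shuffleSign_eq_one {V : Type} [Fintype V] [LinearOrder V] (d e : V → ℤ)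
    (h : ∀ x y, x < y → e y = 0) : shuffleSign d e = 1 := by
  refine Finset.prod_eq_one fun p _ => ?_
  split_ifs with hp
  · simp [h _ _ hp]
  · rfl

/-! ### Two operations on graphs -/

namespace NCGraph

variable {V : Type} {L : V → Type} {E S T : Type}

/-- One vertex and one edge. -/
def single (φ : S ≃ T ⊕ (Unit × Bool)) : NCGraph (fun _ : Unit => S) Unit T where
  flags := (Equiv.uniqueSigma fun _ : Unit => S).trans φ

/-- The two tails of `Γ` that `ψ` sends to the second summand are joined to a new edge, which comes
before all the others. -/
def addEdge (Γ : NCGraph L E S) (ψ : S ≃ T ⊕ (Unit × Bool)) : NCGraph L (Unit ⊕ₗ E) T where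
  flags :=
    calc (Σ v, L v)
      _ ≃ S ⊕ (E × Bool) := Γ.flags
      _ ≃ (T ⊕ (Unit × Bool)) ⊕ (E × Bool) := Equiv.sumCongr ψ (Equiv.refl _)
      _ ≃ T ⊕ ((Unit × Bool) ⊕ (E × Bool)) := Equiv.sumAssoc _ _ _
      _ ≃ T ⊕ ((Unit ⊕ₗ E) × Bool) := Equiv.sumCongr (Equiv.refl T)
            ((Equiv.sumProdDistrib Unit E Bool).symm.trans
              (Equiv.prodCongr toLex (Equiv.refl Bool)))

theorem single_flags (φ : S ≃ T ⊕ (Unit × Bool)) (u : Unit) (x : S) :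
    (single φ).flags ⟨u, x⟩ = φ x :=
  rfl

/-- This and the analogous formulas for `disjUnion` and `subst` unfold the chains of equivalences
once, so that graph isomorphisms can be checked flag by flag. -/
theorem addEdge_flags (Γ : NCGraph L E S) (ψ : S ≃ T ⊕ (Unit × Bool)) (f : Σ v, L v) :
    (Γ.addEdge ψ).flags f =
      Sum.elim (fun s => Sum.map id (Prod.map (fun e => toLex (Sum.inl e)) id) (ψ s))
        (fun p => Sum.inr (toLex (Sum.inr p.1), p.2)) (Γ.flags f) := by
  rcases h : Γ.flags f with s | ⟨e, b⟩
  · rcases h' : ψ s with t | ⟨⟨⟩, b⟩ <;> simp [addEdge, Trans.trans, h, h']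
  · simp [addEdge, Trans.trans, h]

/-- An isomorphism that preserves the directions of the edges. -/
def Iso.ofFlags {V' : Type} {L' : V' → Type} {E' S' : Type}
    {Γ : NCGraph L E S} {Γ' : NCGraph L' E' S'} {τ : S ≃ S'}
    (onV : V ≃ V') (onL : ∀ v, L v ≃ L' (onV v)) (onE : E ≃ E')
    (h : ∀ v x, Γ'.flags ⟨onV v, onL v x⟩ = Sum.map τ (Prod.map onE id) (Γ.flags ⟨v, x⟩)) :
    Γ.Iso Γ' τ where
  onV := onV
  onL := onL
  onE := onE
  tail v x s hs := by rw [h, hs]; rfl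
  edge v x e b hs := ⟨b, by rw [h, hs]; rfl⟩

/-- The disjoint union of two graphs. -/
def disjUnion {W : Type} {M : W → Type} {F : Type} (Γ : NCGraph L E S) (Δ : NCGraph M F T) :
    NCGraph (V := V ⊕ₗ W) (fun p => Sum.elim L M (ofLex p)) (E ⊕ₗ F) (S ⊕ T) where
  flags :=
    calc (Σ p : V ⊕ₗ W, Sum.elim L M (ofLex p))
      _ ≃ (Σ p : V ⊕ W, Sum.elim L M p) := Equiv.sigmaCongr ofLex fun _ => Equiv.refl _
      _ ≃ (Σ v, L v) ⊕ (Σ w, M w) := Equiv.sumSigmaDistrib _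
      _ ≃ (S ⊕ (E × Bool)) ⊕ (T ⊕ (F × Bool)) := Equiv.sumCongr Γ.flags Δ.flags
      _ ≃ (S ⊕ T) ⊕ ((E × Bool) ⊕ (F × Bool)) := Equiv.sumSumSumComm _ _ _ _
      _ ≃ (S ⊕ T) ⊕ ((E ⊕ₗ F) × Bool) := Equiv.sumCongr (Equiv.refl _)
            ((Equiv.sumProdDistrib E F Bool).symm.trans
              (Equiv.prodCongr toLex (Equiv.refl Bool)))

section
variable {W : Type} {M : W → Type} {F : Type} (Γ : NCGraph L E S) (Δ : NCGraph M F T)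

theorem disjUnion_flags_inl (v : V) (x : L v) :
    (Γ.disjUnion Δ).flags ⟨toLex (Sum.inl v), x⟩ =
      Sum.map Sum.inl (Prod.map (fun e => toLex (Sum.inl e)) id) (Γ.flags ⟨v, x⟩) := by
  rcases h : Γ.flags ⟨v, x⟩ with s | ⟨e, b⟩ <;>
  simp [disjUnion, Trans.trans, Equiv.sigmaCongr, Equiv.sumSigmaDistrib, h]

theorem disjUnion_flags_inr (w : W) (x : M w) :
    (Γ.disjUnion Δ).flags ⟨toLex (Sum.inr w), x⟩ =
      Sum.map Sum.inr (Prod.map (fun e => toLex (Sum.inr e)) id) (Δ.flags ⟨w, x⟩) := by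
  rcases h : Δ.flags ⟨w, x⟩ with s | ⟨e, b⟩ <;>
  simp [disjUnion, Trans.trans, Equiv.sigmaCongr, Equiv.sumSigmaDistrib, h]

end

theorem subst_flags {W : V → Type} {M : ∀ v, W v → Type} {F : V → Type}
    (Γ : NCGraph L E S) (Δ : ∀ v, NCGraph (M v) (F v) (L v)) (v : V) (x : W v) (y : M v x) :
    (Γ.subst Δ).flags ⟨toLex ⟨v, x⟩, y⟩ =
      Sum.elim (fun l => Sum.map id (Prod.map (fun e => toLex (Sum.inl e)) id) (Γ.flags ⟨v, l⟩))
        (fun p => Sum.inr (toLex (Sum.inr (toLex ⟨v, p.1⟩)), p.2)) ((Δ v).flags ⟨x, y⟩) := by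
  rcases h : (Δ v).flags ⟨x, y⟩ with l | ⟨e, b⟩
  · rcases h' : Γ.flags ⟨v, l⟩ with s | ⟨e, b⟩ <;>
    simp [subst, Trans.trans, Equiv.sigmaCongr, Equiv.sigmaAssoc, Equiv.sigmaSumDistrib, h, h']
  · simp [subst, Trans.trans, Equiv.sigmaCongr, Equiv.sigmaAssoc, Equiv.sigmaSumDistrib,
      Equiv.sigmaProdDistrib, h]

end NCGraph

/-! ### Contraction of one pair of flags as a linear operator. -/

namespace NCKModularOperad

variable {k : Type u} [Field k] {w : ℤˣ} (O : NCKModularOperad.{u, v} k w)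

/-- Equivariance for isomorphisms that preserve the orders of vertices and edges. -/
theorem comp_iso_of_lt {V : Type} [Finite V] [LinearOrder V] [Nonempty V] {L : V → Type}
    [∀ v, Finite (L v)] {E : Type} [Finite E] [LinearOrder E] {S : Type} [Finite S]
    {V' : Type} [Finite V'] [LinearOrder V'] [Nonempty V'] {L' : V' → Type}
    [∀ v, Finite (L' v)] {E' : Type} [Finite E'] [LinearOrder E'] {S' : Type} [Finite S']
    (Γ : NCGraph L E S) (Γ' : NCGraph L' E' S') (τ : S ≃ S') (φ : Γ.Iso Γ' τ)
    (hV : ∀ x y, x < y → φ.onV x < φ.onV y) (hE : ∀ x y, x < y → φ.onE x < φ.onE y)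
    (γ d : V → ℤ) (a : ∀ v, O.obj (L v)) (ha : ∀ v, a v ∈ O.gr (L v) (γ v) (d v))
    (a' : ∀ v, O.obj (L' v)) (haa' : ∀ v, a' (φ.onV v) = O.map (φ.onL v) (a v)) :
    O.comp Γ' a' = O.map τ (O.comp Γ a) := by
  cases nonempty_fintype V
  cases nonempty_fintype E
  rw [O.comp_iso Γ Γ' τ φ γ d a ha a' haa', koszulSign_eq_one_of_lt _ _ hV,
    koszulSign_eq_one_of_lt _ _ hE, one_mul, one_smul]

variable {S T : Type} [Finite S] [Finite T]

theorem update_unit {X : Type*} (f : Unit → X) (x : X) :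
    Function.update f () x = fun _ => x :=
  funext fun _ => Function.update_self _ _ _

/-- The composition along a graph with one vertex and one edge. -/
def contr (φ : S ≃ T ⊕ (Unit × Bool)) : O.obj S →ₗ[k] O.obj T where
  toFun a := O.comp (NCGraph.single φ) fun _ => a
  map_add' a b := by
    have := (O.comp (NCGraph.single φ)).map_update_add (fun _ => a) () a b
    simpa only [update_unit] using this
  map_smul' c a := by
    have := (O.comp (NCGraph.single φ)).map_update_smul (fun _ => a) () c a
    simpa only [update_unit, RingHom.id_apply] using this

/-- Associativity for an outer graph with a single vertex. No sign appears: there is no earlier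
vertex to move past, and the edge of the outer graph comes first on both sides. -/
theorem contr_comp {V : Type} [Finite V] [LinearOrder V] [Nonempty V] {L : V → Type}
    [∀ v, Finite (L v)] {E : Type} [Finite E] [LinearOrder E] (Γ : NCGraph L E S)
    (ψ : S ≃ T ⊕ (Unit × Bool)) (γ d : V → ℤ) (a : ∀ v, O.obj (L v))
    (ha : ∀ v, a v ∈ O.gr (L v) (γ v) (d v)) :
    O.contr ψ (O.comp Γ a) = O.comp (Γ.addEdge ψ) a := by
  cases nonempty_fintype V
  cases nonempty_fintype E
  have h := O.comp_subst (NCGraph.single ψ) (fun _ => Γ) (fun _ => γ) (fun _ => d) (fun _ => a)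
    fun _ => ha
  rw [shuffleSign_eq_one _ _ (fun x y h => absurd rfl h.ne), one_smul] at h
  refine h.trans ?_
  let φ : (Γ.addEdge ψ).Iso ((NCGraph.single ψ).subst fun _ => Γ) (Equiv.refl T) :=
    NCGraph.Iso.ofFlags ((Equiv.uniqueSigma fun _ : Unit => V).symm.trans toLex)
      (fun v => Equiv.refl _)
      (ofLex.trans ((Equiv.sumCongr (Equiv.refl _)
        ((Equiv.uniqueSigma fun _ : Unit => E).symm.trans toLex)).trans toLex))
      (by
        intro v x
        refine (NCGraph.subst_flags (NCGraph.single ψ) (fun _ => Γ) () v x).trans ?_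
        rw [NCGraph.addEdge_flags]
        rcases h1 : Γ.flags ⟨v, x⟩ with y | ⟨e, b⟩
        · simp only [NCGraph.single_flags, Sum.elim_inl]
          rcases h2 : ψ y with t | ⟨⟨⟩, b⟩ <;> rfl
        · rfl)
  rw [O.comp_iso_of_lt (Γ.addEdge ψ) _ (Equiv.refl T) φ _ _ γ d a ha _
    (fun v => (O.map_refl _).symm), O.map_refl]
  · intro x y hxy
    exact Sigma.Lex.lt_def.2 (Or.inr ⟨rfl, hxy⟩)
  · intro x y hxy
    induction x using Lex.rec with | _ x
    induction y using Lex.rec with | _ y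
    rw [Sum.Lex.toLex_lt_toLex] at hxy
    refine Sum.Lex.toLex_lt_toLex.2 ?_
    rcases hxy with h | h | _
    · exact Sum.Lex.inl h
    · exact Sum.Lex.inr (Sigma.Lex.lt_def.2 (Or.inr ⟨rfl, h⟩))
    · exact Sum.Lex.sep _ _

end NCKModularOperad

/-! ### Horizontal composition along disjoint unions of graphs. -/

namespace NCGraph

/-- The flags at the vertices of two graphs. -/
def pairFlags {V W : Type} (L : V → Type) (M : W → Type) : ∀ v : Bool, pair V W v → Type
  | false => L
  | true => M

instance pairFlags_finite {V W : Type} (L : V → Type) (M : W → Type) [∀ v, Finite (L v)]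
    [∀ v, Finite (M v)] : ∀ (v : Bool) (x : pair V W v), Finite (pairFlags L M v x)
  | false, x => inferInstanceAs (Finite (L x))
  | true, x => inferInstanceAs (Finite (M x))

instance pair_fintype (V W : Type) [Fintype V] [Fintype W] : ∀ v, Fintype (pair V W v)
  | false => ‹Fintype V›
  | true => ‹Fintype W›

instance pair_linearOrder (V W : Type) [LinearOrder V] [LinearOrder W] :
    ∀ v, LinearOrder (pair V W v)
  | false => ‹LinearOrder V›
  | true => ‹LinearOrder W›

instance pair_nonempty (V W : Type) [Nonempty V] [Nonempty W] : ∀ v, Nonempty (pair V W v)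
  | false => ‹Nonempty V›
  | true => ‹Nonempty W›

/-- Two graphs, as a family. -/
def pairGraph {V W : Type} {L : V → Type} {M : W → Type} {E F S T : Type}
    (Γ : NCGraph L E S) (Δ : NCGraph M F T) :
    ∀ v, NCGraph (pairFlags L M v) (pair E F v) (pair S T v)
  | false => Γ
  | true => Δ

/-- Lexicographic sums of two types. -/
def pairLex (V W : Type) : V ⊕ₗ W ≃ Σₗ v, pair V W v :=
  (ofLex.trans (Equiv.sumEquivSigmaBool V W)).trans toLex

theorem pairLex_lt {V W : Type} [LinearOrder V] [LinearOrder W] (x y : V ⊕ₗ W) (h : x < y) :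
    pairLex V W x < pairLex V W y := by
  induction x using Lex.rec with | _ x
  induction y using Lex.rec with | _ y
  rw [Sum.Lex.toLex_lt_toLex] at h
  rcases h with h | h | _
  · exact Sigma.Lex.lt_def.2 (Or.inr ⟨rfl, h⟩)
  · exact Sigma.Lex.lt_def.2 (Or.inr ⟨rfl, h⟩)
  · exact Sigma.Lex.lt_def.2 (Or.inl (by decide : false < true))

theorem merger_flags_false {S T : Type} (x : S) :
    (merger S T).flags ⟨false, x⟩ = Sum.inl (Sum.inl x) :=
  rfl

theorem merger_flags_true {S T : Type} (x : T) :
    (merger S T).flags ⟨true, x⟩ = Sum.inl (Sum.inr x) :=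
  rfl

instance elim_finite {V W : Type} (L : V → Type) (M : W → Type) [∀ v, Finite (L v)]
    [∀ v, Finite (M v)] : ∀ x : V ⊕ W, Finite (Sum.elim L M x)
  | Sum.inl x => inferInstanceAs (Finite (L x))
  | Sum.inr x => inferInstanceAs (Finite (M x))

end NCGraph

namespace NCKModularOperad

open NCGraph

variable {k : Type u} [Field k] {w : ℤˣ} (O : NCKModularOperad.{u, v} k w)
variable {S T : Type} [Finite S] [Finite T]

/-- The decoration of the disjoint union of two decorated graphs. -/
def sumElt {V W : Type} {L : V → Type} {M : W → Type} [∀ v, Finite (L v)] [∀ v, Finite (M v)]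
    (a : ∀ v, O.obj (L v)) (b : ∀ v, O.obj (M v)) :
    ∀ x : V ⊕ W, O.obj (Sum.elim L M x)
  | Sum.inl x => a x
  | Sum.inr x => b x

/-- The family of two decorations. -/
def pairDec {V W : Type} {L : V → Type} {M : W → Type} [∀ v, Finite (L v)] [∀ v, Finite (M v)]
    (a : ∀ v, O.obj (L v)) (b : ∀ v, O.obj (M v)) :
    ∀ (v : Bool) (x : pair V W v), O.obj (pairFlags L M v x)
  | false => a
  | true => b

/-- Horizontal composition of two compositions, the second one along a graph without edges. -/
theorem hmul_comp {V : Type} [Finite V] [LinearOrder V] [Nonempty V] {L : V → Type}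
    [∀ v, Finite (L v)] {E : Type} [Finite E] [LinearOrder E] (Γ : NCGraph L E S)
    {W : Type} [Finite W] [LinearOrder W] [Nonempty W] {M : W → Type}
    [∀ v, Finite (M v)] {F : Type} [Finite F] [LinearOrder F] [IsEmpty F] (Δ : NCGraph M F T)
    (γ d : V → ℤ) (a : ∀ v, O.obj (L v)) (ha : ∀ v, a v ∈ O.gr (L v) (γ v) (d v))
    (γ' d' : W → ℤ) (b : ∀ v, O.obj (M v)) (hb : ∀ v, b v ∈ O.gr (M v) (γ' v) (d' v)) :
    O.hmul (O.comp Γ a) (O.comp Δ b) =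
      O.comp (Γ.disjUnion Δ) fun p => O.sumElt a b (ofLex p) := by
  cases nonempty_fintype V
  cases nonempty_fintype E
  cases nonempty_fintype W
  cases nonempty_fintype F
  have h := O.comp_subst (merger S T) (pairGraph Γ Δ)
    (fun v => match v with | false => γ | true => γ')
    (fun v => match v with | false => d | true => d') (O.pairDec a b)
    (by rintro (_ | _); exacts [ha, hb])
  -- The only possible sign comes from moving the edges of `Δ` past the decorations of `Γ`, and `F`
  -- is empty.
  rw [shuffleSign_eq_one, one_smul] at h
  swap
  · rintro (_ | _) (_ | _) h
    · exact absurd h (lt_irrefl _)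
    · exact Nat.cast_eq_zero.2 (Fintype.card_eq_zero (α := F))
    · exact absurd h (by decide)
    · exact absurd h (lt_irrefl _)
  have h0 : O.pairElt (O.comp Γ a) (O.comp Δ b) =
      fun v => O.comp (pairGraph Γ Δ v) (O.pairDec a b v) := by
    funext v; cases v <;> rfl
  rw [hmul, h0, h]
  let φ : (Γ.disjUnion Δ).Iso ((merger S T).subst (pairGraph Γ Δ)) (Equiv.refl _) :=
    NCGraph.Iso.ofFlags (pairLex V W)
      (fun v => match v with
        | Sum.inl v => Equiv.refl (L v)
        | Sum.inr v => Equiv.refl (M v))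
      (ofLex.trans (((Equiv.emptySum (Fin 0) _).symm.trans
        (Equiv.sumCongr (Equiv.refl (Fin 0)) (toLex.trans (pairLex E F)))).trans toLex))
      (by
        rintro (v | v) x
        · refine (subst_flags (merger S T) (pairGraph Γ Δ) false v x).trans ?_
          refine Eq.trans ?_ (congrArg _ (disjUnion_flags_inl Γ Δ v x).symm)
          change Sum.elim _ _ (Γ.flags ⟨v, x⟩) = _
          rcases h1 : Γ.flags ⟨v, x⟩ with y | ⟨e, b⟩ <;> rfl
        · refine (subst_flags (merger S T) (pairGraph Γ Δ) true v x).trans ?_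
          refine Eq.trans ?_ (congrArg _ (disjUnion_flags_inr Γ Δ v x).symm)
          change Sum.elim _ _ (Δ.flags ⟨v, x⟩) = _
          rcases h1 : Δ.flags ⟨v, x⟩ with y | ⟨e, b⟩ <;> rfl)
  rw [O.comp_iso_of_lt (Γ.disjUnion Δ) _ (Equiv.refl _) φ (fun x y h => pairLex_lt x y h) _
    (Sum.elim γ γ' ∘ ofLex) (Sum.elim d d' ∘ ofLex) (fun p => O.sumElt a b (ofLex p)) _ _ _,
    O.map_refl]
  · intro x y hxy
    exact Sum.Lex.toLex_lt_toLex.2 (Sum.Lex.inr (pairLex_lt x y hxy))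
  · rintro (v | v)
    · exact ha v
    · exact hb v
  · rintro (v | v)
    · exact (O.map_refl _).symm
    · exact (O.map_refl _).symm

end NCKModularOperad

/-! ### Sign scalars, extended contractions and bracketings of vertices. -/

theorem map_sign_smul {k A B : Type*} [Semiring k] [AddCommGroup A] [AddCommGroup B] [Module k A]
    [Module k B] (f : A →ₗ[k] B) (u : ℤˣ) (x : A) : f (u • x) = u • f x := by
  rw [Units.smul_def, Units.smul_def, map_zsmul]

theorem map_sign_smul_left {k A B C : Type*} [CommSemiring k] [AddCommGroup A] [AddCommGroup B]
    [AddCommGroup C] [Module k A] [Module k B] [Module k C] (f : A →ₗ[k] B →ₗ[k] C) (u : ℤˣ) (x : A)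
    (y : B) : f (u • x) y = u • f x y := by
  rw [map_sign_smul, Units.smul_def, Units.smul_def, LinearMap.smul_apply]

theorem sign_smul_apply {k A B : Type*} [Semiring k] [AddCommGroup A] [AddCommGroup B] [Module k A]
    [Module k B] (u : ℤˣ) (f : A →ₗ[k] B) (x : A) : (u • f) x = u • f x := by
  rw [Units.smul_def, Units.smul_def, LinearMap.smul_apply]

/-- The extension of a contraction of flags by flags on the right. -/
def extendRight {S T : Type} (φ : S ≃ T ⊕ (Unit × Bool)) (U : Type) :
    S ⊕ U ≃ (T ⊕ U) ⊕ (Unit × Bool) :=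
  (((Equiv.sumCongr φ (Equiv.refl U)).trans (Equiv.sumAssoc _ _ _)).trans
    (Equiv.sumCongr (Equiv.refl T) (Equiv.sumComm _ _))).trans (Equiv.sumAssoc _ _ _).symm

/-- The extension of a contraction of flags by flags on the left. -/
def extendLeft {S T : Type} (U : Type) (φ : S ≃ T ⊕ (Unit × Bool)) :
    U ⊕ S ≃ (U ⊕ T) ⊕ (Unit × Bool) :=
  (Equiv.sumCongr (Equiv.refl U) φ).trans (Equiv.sumAssoc _ _ _).symm

/-- The two bracketings of three vertices. -/
def assocLex : Bool ⊕ₗ Unit ≃ Unit ⊕ₗ Bool where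
  toFun x := match ofLex x with
    | Sum.inl false => toLex (Sum.inl ())
    | Sum.inl true => toLex (Sum.inr false)
    | Sum.inr () => toLex (Sum.inr true)
  invFun x := match ofLex x with
    | Sum.inl () => toLex (Sum.inl false)
    | Sum.inr false => toLex (Sum.inl true)
    | Sum.inr true => toLex (Sum.inr ())
  left_inv := by rintro ((_ | _) | _) <;> rfl
  right_inv := by rintro (_ | (_ | _)) <;> rfl

theorem assocLex_lt : ∀ x y, x < y → assocLex x < assocLex y := by
  decide

/-- Two vertices as a lexicographic sum. -/
def boolLex : Bool ≃ Unit ⊕ₗ Unit where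
  toFun x := match x with
    | false => toLex (Sum.inl ())
    | true => toLex (Sum.inr ())
  invFun x := match ofLex x with
    | Sum.inl () => false
    | Sum.inr () => true
  left_inv := by rintro (_ | _) <;> rfl
  right_inv := by rintro (_ | _) <;> rfl

theorem boolLex_lt : ∀ x y, x < y → boolLex x < boolLex y := by
  decide

namespace NCKModularOperad

open NCGraph

variable {k : Type u} [Field k] {w : ℤˣ} (O : NCKModularOperad.{u, v} k w)
variable {S T U : Type} [Finite S] [Finite T] [Finite U]

/-- Equivariance and associativity are axioms for homogeneous decorations only; this carries their
additive consequences to all elements. -/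
theorem obj_induction {p : O.obj S → Prop} (hom : ∀ γ d a, a ∈ O.gr S γ d → p a)
    (add : ∀ a b, p a → p b → p (a + b)) (a : O.obj S) : p a := by
  have h : a ∈ ⨆ q : ℤ × ℤ, O.gr S q.1 q.2 := by
    rw [(O.isInternal S).submodule_iSup_eq_top]; trivial
  exact Submodule.iSup_induction (motive := p) (fun q : ℤ × ℤ => O.gr S q.1 q.2) h (fun q a => hom q.1 q.2 a)
    (hom 0 0 0 (zero_mem _)) add

theorem comp_corolla_unit (a : Unit → O.obj S) : O.comp (corolla S) a = a () :=
  O.comp_corolla (a ())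

/-! #### Horizontal composition -/

theorem pairElt_update_false (a a' : O.obj S) (b : O.obj T) :
    Function.update (O.pairElt a b) false a' = O.pairElt a' b := by
  funext v; cases v
  · exact Function.update_self _ _ _
  · exact Function.update_of_ne (by decide) _ _

theorem pairElt_update_true (a : O.obj S) (b b' : O.obj T) :
    Function.update (O.pairElt a b) true b' = O.pairElt a b' := by
  funext v; cases v
  · exact Function.update_of_ne (by decide) _ _
  · exact Function.update_self _ _ _

/-- The composition along a graph with two vertices, as a bilinear map. -/
def compPair {E R : Type} [Finite E] [LinearOrder E] [Finite R] (Γ : NCGraph (pair S T) E R) :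
    O.obj S →ₗ[k] O.obj T →ₗ[k] O.obj R :=
  LinearMap.mk₂ k (fun a b => O.comp Γ (O.pairElt a b))
    (fun a a' b => by
      have := (O.comp Γ).map_update_add (O.pairElt a b) false a a'
      simpa only [pairElt_update_false] using this)
    (fun c a b => by
      have := (O.comp Γ).map_update_smul (O.pairElt a b) false c a
      simpa only [pairElt_update_false] using this)
    (fun a b b' => by
      have := (O.comp Γ).map_update_add (O.pairElt a b) true b b'
      simpa only [pairElt_update_true] using this)
    (fun c a b => by
      have := (O.comp Γ).map_update_smul (O.pairElt a b) true c b
      simpa only [pairElt_update_true] using this)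

/-- The horizontal composition as a bilinear map. -/
def hmulₗ : O.obj S →ₗ[k] O.obj T →ₗ[k] O.obj (S ⊕ T) :=
  O.compPair (merger S T)

theorem pairElt_mem {γ d γ' d' : ℤ} {a : O.obj S} {b : O.obj T} (ha : a ∈ O.gr S γ d)
    (hb : b ∈ O.gr T γ' d') (v : Bool) :
    O.pairElt a b v ∈ O.gr (pair S T v) (bif v then γ' else γ) (bif v then d' else d) := by
  cases v
  · exact ha
  · exact hb

theorem hmul_mem {γ d γ' d' : ℤ} {a : O.obj S} {b : O.obj T} (ha : a ∈ O.gr S γ d)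
    (hb : b ∈ O.gr T γ' d') : O.hmulₗ a b ∈ O.gr (S ⊕ T) (γ + γ' - 1) (d + d') := by
  have h := O.comp_mem (merger S T) _ _ _ (O.pairElt_mem ha hb)
  change O.hmulₗ a b ∈ _ at h
  convert h using 2
  · simp [totalGamma, eulerChar]
    ring
  · simp [add_comm]

theorem hmul_map {S' T' : Type} [Finite S'] [Finite T'] (f : S ≃ S') (g : T ≃ T') (a : O.obj S)
    (b : O.obj T) :
    O.hmulₗ (O.map f a) (O.map g b) = O.map (Equiv.sumCongr f g) (O.hmulₗ a b) := by
  induction a using O.obj_induction with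
  | add a a' h h' => simp only [map_add, LinearMap.add_apply, h, h']
  | hom γ d a ha =>
    induction b using O.obj_induction with
    | add b b' h h' => simp only [map_add, h, h']
    | hom γ' d' b hb =>
      let φ : (merger S T).Iso (merger S' T') (Equiv.sumCongr f g) :=
        NCGraph.Iso.ofFlags (Equiv.refl _)
          (fun v => match v with | false => f | true => g) (Equiv.refl _)
          (by rintro (_ | _) x <;> rfl)
      refine O.comp_iso_of_lt _ _ _ φ (fun _ _ h => h) (fun _ _ h => h) _ _ _
        (O.pairElt_mem ha hb) _ ?_
      rintro (_ | _) <;> rfl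

/-- Interchanging the vertices is an isomorphism of graphs without edges, so only the transposition
of the two decorations contributes. -/
theorem hmul_comm {γ d γ' d' : ℤ} {a : O.obj S} {b : O.obj T} (ha : a ∈ O.gr S γ d)
    (hb : b ∈ O.gr T γ' d') :
    O.hmulₗ b a = (d * d').negOnePow • O.map (Equiv.sumComm S T) (O.hmulₗ a b) := by
  let φ : (merger S T).Iso (merger T S) (Equiv.sumComm S T) :=
    NCGraph.Iso.ofFlags Equiv.boolNot
      (fun v => match v with | false => Equiv.refl S | true => Equiv.refl T) (Equiv.refl _)
      (by rintro (_ | _) x <;> rfl)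
  have h := O.comp_iso _ _ _ φ _ _ _ (O.pairElt_mem ha hb) (O.pairElt b a)
    (by rintro (_ | _) <;> exact (O.map_refl _).symm)
  rw [koszulSign_swap φ.onV _ false true (by decide) (by decide)
      (show Equiv.boolNot true < Equiv.boolNot false by decide), koszulSign_of_subsingleton, mul_one] at h
  exact h

/-- Either bracketing is the composition along three isolated vertices in the same order. The lone
factor is written as a composition along a corolla so that `hmul_comp` applies. -/
theorem hmul_assoc (a : O.obj S) (b : O.obj T) (c : O.obj U) :
    O.hmulₗ a (O.hmulₗ b c) = O.map (Equiv.sumAssoc S T U) (O.hmulₗ (O.hmulₗ a b) c) := by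
  induction a using O.obj_induction with
  | add a a' h h' => simp only [map_add, LinearMap.add_apply, h, h']
  | hom γ d a ha =>
  induction b using O.obj_induction with
  | add b b' h h' => simp only [map_add, LinearMap.add_apply, h, h']
  | hom γ' d' b hb =>
  induction c using O.obj_induction with
  | add c c' h h' => simp only [map_add, h, h']
  | hom γ'' d'' c hc =>
  have h1 := O.hmul_comp (merger S T) (corolla U) _ _ _ (O.pairElt_mem ha hb)
    (fun _ => γ'') (fun _ => d'') (fun _ => c) (fun _ => hc)
  have h2 := O.hmul_comp (corolla S) (merger T U)
    (fun _ => γ) (fun _ => d) (fun _ => a) (fun _ => ha) _ _ _ (O.pairElt_mem hb hc)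
  rw [comp_corolla_unit] at h1 h2
  let φ : ((merger S T).disjUnion (corolla U)).Iso ((corolla S).disjUnion (merger T U))
      (Equiv.sumAssoc S T U) :=
    NCGraph.Iso.ofFlags
      assocLex
      (fun v => match v with
        | Sum.inl false => Equiv.refl S
        | Sum.inl true => Equiv.refl T
        | Sum.inr () => Equiv.refl U)
      (Equiv.refl _)
      (by rintro ((_ | _) | _) x <;> rfl)
  refine h2.trans ((O.comp_iso_of_lt _ _ _ φ assocLex_lt (fun _ _ h => h)
    (fun x => Sum.elim (fun v => bif v then γ' else γ) (fun _ => γ'') (ofLex x))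
    (fun x => Sum.elim (fun v => bif v then d' else d) (fun _ => d'') (ofLex x)) _ ?_ _ ?_).trans
    (congrArg _ h1.symm))
  · rintro ((_ | _) | _)
    exacts [ha, hb, hc]
  · rintro ((_ | _) | _) <;> exact (O.map_refl _).symm

/-! #### Contraction of a pair of flags -/

theorem contr_mem (φ : S ≃ T ⊕ (Unit × Bool)) {γ d : ℤ} {a : O.obj S} (ha : a ∈ O.gr S γ d) :
    O.contr φ a ∈ O.gr T (γ + 1) (d + w) := by
  have h := O.comp_mem (single φ) (fun _ => γ) (fun _ => d) (fun _ => a) (fun _ => ha)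
  change O.contr φ a ∈ _ at h
  simpa [totalGamma, eulerChar, add_comm] using h

/-- Isomorphisms may exchange the halves of an edge. Hence `h2` asks only that contracted flags go
to contracted flags, and the direction of the new edge plays no role. -/
theorem contr_map {S' T' : Type} [Finite S'] [Finite T'] (f : S ≃ S') (g : T ≃ T')
    (φ : S ≃ T ⊕ (Unit × Bool)) (φ' : S' ≃ T' ⊕ (Unit × Bool))
    (h1 : ∀ x t, φ x = Sum.inl t → φ' (f x) = Sum.inl (g t))
    (h2 : ∀ x p, φ x = Sum.inr p → ∃ p', φ' (f x) = Sum.inr p') (a : O.obj S) :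
    O.contr φ' (O.map f a) = O.map g (O.contr φ a) := by
  induction a using O.obj_induction with
  | add a a' h h' => simp only [map_add, h, h']
  | hom γ d a ha =>
    let ι : (single φ).Iso (single φ') g :=
      { onV := Equiv.refl _
        onL := fun _ => f
        onE := Equiv.refl _
        tail := fun v x s h => h1 x s h
        edge := fun v x e b h => by
          obtain ⟨⟨e', b'⟩, h'⟩ := h2 x _ h
          exact ⟨b', h'⟩ }
    exact O.comp_iso_of_lt _ _ _ ι (fun _ _ h => h) (fun _ _ h => h) (fun _ => γ) (fun _ => d) _
      (fun _ => ha) _ (fun _ => rfl)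

/-- Two contractions anticommute. -/
theorem contr_contr {S' T' U' : Type} [Finite S'] [Finite T'] [Finite U'] (f : S ≃ S') (g : U ≃ U')
    (φ : S ≃ T ⊕ (Unit × Bool)) (ψ : T ≃ U ⊕ (Unit × Bool))
    (φ' : S' ≃ T' ⊕ (Unit × Bool)) (ψ' : T' ≃ U' ⊕ (Unit × Bool))
    (h1 : ∀ x t r, φ x = Sum.inl t → ψ t = Sum.inl r →
      ∃ t', φ' (f x) = Sum.inl t' ∧ ψ' t' = Sum.inl (g r))
    (h2 : ∀ x t p, φ x = Sum.inl t → ψ t = Sum.inr p → ∃ p', φ' (f x) = Sum.inr p')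
    (h3 : ∀ x p, φ x = Sum.inr p → ∃ t' p', φ' (f x) = Sum.inl t' ∧ ψ' t' = Sum.inr p')
    (a : O.obj S) :
    O.contr ψ' (O.contr φ' (O.map f a)) = -O.map g (O.contr ψ (O.contr φ a)) := by
  induction a using O.obj_induction with
  | add a a' h h' => simp only [map_add, h, h', neg_add]
  | hom γ d a ha =>
    let ι : ((single φ).addEdge ψ).Iso ((single φ').addEdge ψ') g :=
      { onV := Equiv.refl _
        onL := fun _ => f
        -- The edge made first on one side is made last on the other, so the two odd edges are
        -- transposed; this is the source of the minus sign.
        onE := (ofLex.trans (Equiv.sumComm _ _)).trans toLex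
        tail := fun v x s h => by
          rw [addEdge_flags, single_flags] at h
          rcases h4 : φ x with t | p
          · rcases h5 : ψ t with r | p
            · obtain ⟨t', h6, h7⟩ := h1 x t r h4 h5
              rw [h4, Sum.elim_inl, h5] at h
              rw [addEdge_flags, single_flags, h6, Sum.elim_inl, h7]
              cases h; rfl
            · rw [h4, Sum.elim_inl, h5] at h
              cases h
          · rw [h4] at h
            cases h
        edge := fun v x e b h => by
          rw [addEdge_flags, single_flags] at h
          rcases h4 : φ x with t | p
          · rcases h5 : ψ t with r | p
            · rw [h4, Sum.elim_inl, h5] at h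
              cases h
            · rw [h4, Sum.elim_inl, h5] at h
              obtain ⟨⟨e', b'⟩, h6⟩ := h2 x t p h4 h5
              cases h
              exact ⟨b', by rw [addEdge_flags, single_flags, h6]; rfl⟩
          · rw [h4] at h
            obtain ⟨t', ⟨e', b'⟩, h6, h7⟩ := h3 x p h4
            cases h
            exact ⟨b', by rw [addEdge_flags, single_flags, h6, Sum.elim_inl, h7]; rfl⟩ }
    have h := O.comp_iso _ _ _ ι (fun _ => γ) (fun _ => d) (fun _ => a) (fun _ => ha)
      (fun _ => O.map f a) (fun _ => rfl)
    rw [koszulSign_of_subsingleton, koszulSign_swap ι.onE _ (toLex (Sum.inl ())) (toLex (Sum.inr ()))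
      (by decide) (by decide)
      (show (toLex (Sum.inl ()) : Unit ⊕ₗ Unit) < toLex (Sum.inr ()) by decide)] at h
    have h4 := O.contr_comp (single φ) ψ _ _ _ (fun _ => ha)
    have h5 := O.contr_comp (single φ') ψ' _ _ _ (fun _ => O.map_mem f ha)
    refine h5.trans (h.trans ?_)
    rw [← h4]
    simp [Units.smul_def]
    rfl

/-- Both sides are the composition along two vertices with a loop at the first one; the odd edge
already stands in front of both decorations. -/
theorem hmul_contr_left (φ : S ≃ T ⊕ (Unit × Bool)) (a : O.obj S) (b : O.obj U) :
    O.hmulₗ (O.contr φ a) b = O.contr (extendRight φ U) (O.hmulₗ a b) := by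
  induction a using O.obj_induction with
  | add a a' h h' => simp only [map_add, LinearMap.add_apply, h, h']
  | hom γ d a ha =>
  induction b using O.obj_induction with
  | add b b' h h' => simp only [map_add, h, h']
  | hom γ' d' b hb =>
  have h1 := O.hmul_comp (single φ) (corolla U) (fun _ => γ) (fun _ => d) (fun _ => a) (fun _ => ha)
    (fun _ => γ') (fun _ => d') (fun _ => b) (fun _ => hb)
  have h2 := O.contr_comp (merger S U) (extendRight φ U) _ _ _ (O.pairElt_mem ha hb)
  rw [comp_corolla_unit] at h1
  let ι : ((merger S U).addEdge (extendRight φ U)).Iso ((single φ).disjUnion (corolla U))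
      (Equiv.refl _) :=
    NCGraph.Iso.ofFlags
      boolLex
      (fun v => match v with
        | false => Equiv.refl S
        | true => Equiv.refl U)
      (Equiv.refl _)
      (by
        rintro (_ | _) x
        · rw [addEdge_flags, merger_flags_false]
          refine (disjUnion_flags_inl (single φ) (corolla U) () x).trans ?_
          rw [single_flags]
          simp only [Sum.elim_inl, extendRight, Equiv.trans_apply, Equiv.sumCongr_apply,
            Sum.map_inl]
          rcases φ x with t | ⟨⟨⟩, b⟩ <;> rfl
        · rfl)
  refine h1.trans ((O.comp_iso_of_lt _ _ _ ι boolLex_lt (fun _ _ h => h) _ _ _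
    (O.pairElt_mem ha hb) _ ?_).trans ((O.map_refl _).trans h2.symm))
  rintro (_ | _) <;> exact (O.map_refl _).symm

/-- Conjugating `hmul_contr_left` by `hmul_comm`: contraction changes the degree of `b` by the odd
number `w`, so the two commutation signs differ by (-1)^`d`. -/
theorem hmul_contr_right (φ : S ≃ T ⊕ (Unit × Bool)) {γ d : ℤ} {a : O.obj U}
    (ha : a ∈ O.gr U γ d) (b : O.obj S) :
    O.hmulₗ a (O.contr φ b) = d.negOnePow • O.contr (extendLeft U φ) (O.hmulₗ a b) := by
  induction b using O.obj_induction with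
  | add b b' h h' => simp only [map_add, h, h', smul_add]
  | hom γ' d' b hb =>
    rw [O.hmul_comm (O.contr_mem φ hb) ha, hmul_contr_left, O.hmul_comm hb ha, map_sign_smul,
      O.contr_map (Equiv.sumComm S U) (Equiv.sumComm T U) (extendRight φ U) (extendLeft U φ),
      smul_smul, ← Int.negOnePow_add]
    · congr 1
      rw [Int.negOnePow_eq_iff]
      -- The exponents differ by `w * d - d`, which is even for either value of `w`.
      rcases Int.units_eq_one_or w with rfl | rfl
      · exact ⟨0, by push_cast; ring⟩
      · exact ⟨-d, by push_cast; ring⟩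
    · rintro (x | x) t h
      · simp only [extendRight, extendLeft, Equiv.trans_apply, Equiv.sumCongr_apply,
          Sum.map_inl, Equiv.sumComm_apply, Sum.swap_inl, Sum.map_inr] at h ⊢
        rcases h1 : φ x with y | p <;> rw [h1] at h
        · cases h; rfl
        · cases h
      · cases h; rfl
    · rintro (x | x) t h
      · simp only [extendRight, extendLeft, Equiv.trans_apply, Equiv.sumCongr_apply,
          Sum.map_inl, Equiv.sumComm_apply, Sum.swap_inl, Sum.map_inr] at h ⊢
        rcases h1 : φ x with y | p <;> rw [h1] at h
        · cases h
        exact ⟨_, rfl⟩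
      · cases h

/-! #### The gluings -/

/-- The two flags to be glued and the other ones. -/
noncomputable def gluePair (s : S) (t : T) :
    S ⊕ T ≃ ({x : S // x ≠ s} ⊕ {y : T // y ≠ t}) ⊕ (Unit × Bool) :=
  (Equiv.sumEquivSigmaBool S T).trans (bridge s t).flags

/-- Adding the edge between `s` and `t` to two isolated vertices produces the bridge. From here on
only `hmulₗ` and `contr` are needed. -/
theorem glue_eq (s : S) (t : T) (a : O.obj S) (b : O.obj T) :
    O.glue s t a b = O.contr (gluePair s t) (O.hmulₗ a b) := by
  change O.compPair (bridge s t) a b = _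
  induction a using O.obj_induction with
  | add a a' h h' => simp only [map_add, LinearMap.add_apply, h, h']
  | hom γ d a ha =>
  induction b using O.obj_induction with
  | add b b' h h' => simp only [map_add, h, h']
  | hom γ' d' b hb =>
  have h2 := O.contr_comp (merger S T) (gluePair s t) _ _ _ (O.pairElt_mem ha hb)
  let ι : ((merger S T).addEdge (gluePair s t)).Iso (bridge s t) (Equiv.refl _) :=
    NCGraph.Iso.ofFlags (Equiv.refl _) (fun v => Equiv.refl _)
      (ofLex.trans (Equiv.sumEmpty _ _))
      (by
        rintro (_ | _) x
        · rw [addEdge_flags, merger_flags_false, Sum.elim_inl]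
          change gluePair s t (Sum.inl x) = _
          rcases gluePair s t (Sum.inl x) with y | ⟨⟨⟩, b⟩ <;> rfl
        · rw [addEdge_flags, merger_flags_true, Sum.elim_inl]
          change gluePair s t (Sum.inr x) = _
          rcases gluePair s t (Sum.inr x) with y | ⟨⟨⟩, b⟩ <;> rfl)
  refine ((O.comp_iso_of_lt _ _ _ ι (fun _ _ h => h) ?_ _ _ _
    (O.pairElt_mem ha hb) _ (fun _ => (O.map_refl _).symm)).trans ((O.map_refl _).trans h2.symm))
  have : ∀ x y : Unit ⊕ₗ Fin 0, ¬ x < y := by decide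
  exact fun x y h => absurd h (this x y)

/-- The two flags to be glued and the other ones. -/
noncomputable def selfGluePair (s s' : S) (h : s ≠ s') :
    S ≃ {x : S // x ≠ s ∧ x ≠ s'} ⊕ (Unit × Bool) :=
  (Equiv.uniqueSigma fun _ : Unit => S).symm.trans (loop s s' h).flags

end NCKModularOperad

/-- A family of subspaces that spans and admits projections is a decomposition. -/
theorem DirectSum.isInternal_of_projections {k A ι : Type*} [DecidableEq ι] [Ring k]
    [AddCommGroup A] [Module k A] (𝒜 : ι → Submodule k A) (h : ⨆ i, 𝒜 i = ⊤) (P : ι → A →ₗ[k] A)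
    (hP : ∀ i, ∀ x ∈ 𝒜 i, P i x = x) (hP' : ∀ i j, i ≠ j → ∀ x ∈ 𝒜 j, P i x = 0) :
    DirectSum.IsInternal 𝒜 := by
  rw [DirectSum.isInternal_submodule_iff_iSupIndep_and_iSup_eq_top]
  refine ⟨fun i => ?_, h⟩
  rw [Submodule.disjoint_def]
  intro x hx hx'
  have h1 : ⨆ (j) (_ : j ≠ i), 𝒜 j ≤ LinearMap.ker (P i) :=
    iSup₂_le fun j hj y hy => hP' i j hj.symm y hy
  rw [← hP i x hx]
  exact h1 hx'

/-- The sign `(-1) ^ d` as a scalar. -/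
def parityScalar (k : Type u) [Field k] (d : ℤ) : k :=
  ((d.negOnePow : ℤ) : k)

theorem parityScalar_smul {k : Type u} [Field k] {A : Type*} [AddCommGroup A] [Module k A] (d : ℤ)
    (x : A) : parityScalar k d • x = d.negOnePow • x := by
  rw [parityScalar, Int.cast_smul_eq_zsmul, Units.smul_def]

/-! ### Operators that act by a scalar in each degree. -/

namespace NCKModularOperad

variable {k : Type u} [Field k] {w : ℤˣ} (O : NCKModularOperad.{u, v} k w)

section scale

variable {S T : Type} [Finite S] [Finite T]

/-- The operator that multiplies elements of degree `d` by `c d`. -/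
noncomputable def scale (S : Type) [Finite S] (c : ℤ → k) : O.obj S →ₗ[k] O.obj S :=
  DirectSum.toModule k (ℤ × ℤ) (O.obj S) (fun p => c p.2 • (O.gr S p.1 p.2).subtype) ∘ₗ
    (LinearEquiv.ofBijective (DirectSum.coeLinearMap fun p : ℤ × ℤ => O.gr S p.1 p.2)
      (O.isInternal S)).symm.toLinearMap

theorem scale_of_mem (c : ℤ → k) {γ d : ℤ} {a : O.obj S} (ha : a ∈ O.gr S γ d) :
    O.scale S c a = c d • a := by
  have h : (LinearEquiv.ofBijective (DirectSum.coeLinearMap fun p : ℤ × ℤ => O.gr S p.1 p.2)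
      (O.isInternal S)).symm a =
      DirectSum.lof k (ℤ × ℤ) (fun p : ℤ × ℤ => O.gr S p.1 p.2) (γ, d) ⟨a, ha⟩ := by
    rw [LinearEquiv.symm_apply_eq]
    exact (DirectSum.coeLinearMap_lof (fun p : ℤ × ℤ => O.gr S p.1 p.2) (γ, d) ⟨a, ha⟩).symm
  rw [scale, LinearMap.comp_apply, LinearEquiv.coe_coe, h, DirectSum.toModule_lof]
  rfl

theorem scale_map (c : ℤ → k) (f : S ≃ T) (a : O.obj S) :
    O.scale T c (O.map f a) = O.map f (O.scale S c a) := by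
  induction a using O.obj_induction with
  | add a a' h h' => simp only [map_add, h, h']
  | hom γ d a ha => rw [O.scale_of_mem c ha, O.scale_of_mem c (O.map_mem f ha), map_smul]

end scale

/-! ### Coinvariants -/

variable {H : ∀ n, Subgroup (Equiv.Perm (Fin n))}

theorem cls_map {n : ℕ} {σ : Equiv.Perm (Fin n)} (hσ : σ ∈ H n) (a : O.obj (Fin n)) :
    O.cls H n (O.map σ a) = O.cls H n a :=
  congrArg (DirectSum.lof k ℕ _ n)
    (Representation.Coinvariants.mk_self_apply ((O.rep n).comp (H n).subtype) ⟨σ, hσ⟩ a)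

theorem coinv_induction {p : O.Coinv H → Prop} (cls : ∀ n a, p (O.cls H n a))
    (add : ∀ x y, p x → p y → p (x + y)) (x : O.Coinv H) : p x := by
  induction x using DirectSum.induction_on with
  | zero => simpa using cls 0 0
  | of n x =>
    obtain ⟨a, rfl⟩ := Representation.Coinvariants.mk_surjective _ x
    exact cls n a
  | add x y hx hy => exact add x y hx hy

theorem degPart_induction {d : ℤ} {p : O.Coinv H → Prop}
    (cls : ∀ n γ a, a ∈ O.gr (Fin n) γ d → p (O.cls H n a))
    (add : ∀ x y, p x → p y → p (x + y)) {x : O.Coinv H} (hx : x ∈ O.degPart H d) : p x := by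
  have h0 : p 0 := by simpa using cls 0 0 0 (zero_mem _)
  refine Submodule.iSup_induction _ (motive := p) hx (fun n y hy => ?_) h0 add
  refine Submodule.iSup_induction _ (motive := p) hy (fun γ z hz => ?_) h0 add
  obtain ⟨a, ha, rfl⟩ := hz
  exact cls n γ a ha

theorem cls_mem_degPart {n : ℕ} {γ d : ℤ} {a : O.obj (Fin n)} (ha : a ∈ O.gr (Fin n) γ d) :
    O.cls H n a ∈ O.degPart H d :=
  Submodule.mem_iSup_of_mem n (Submodule.mem_iSup_of_mem γ ⟨a, ha, rfl⟩)

section lift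

variable {X : Type*} [AddCommGroup X] [Module k X]

/-- The linear map on coinvariants induced by invariant linear maps. -/
noncomputable def coinvLift (f : ∀ n, O.obj (Fin n) →ₗ[k] X)
    (hf : ∀ n, ∀ σ ∈ H n, ∀ a, f n (O.map σ a) = f n a) : O.Coinv H →ₗ[k] X :=
  DirectSum.toModule k ℕ X fun n =>
    Representation.Coinvariants.lift ((O.rep n).comp (H n).subtype) (f n)
      fun σ => LinearMap.ext fun a => hf n σ.1 σ.2 a

theorem coinvLift_cls (f : ∀ n, O.obj (Fin n) →ₗ[k] X)
    (hf : ∀ n, ∀ σ ∈ H n, ∀ a, f n (O.map σ a) = f n a) (n : ℕ) (a : O.obj (Fin n)) :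
    O.coinvLift f hf (O.cls H n a) = f n a := by
  rw [coinvLift, cls, LinearMap.comp_apply, DirectSum.toModule_lof]
  rfl

theorem coinv_hom_ext {f g : O.Coinv H →ₗ[k] X}
    (h : ∀ n a, f (O.cls H n a) = g (O.cls H n a)) : f = g := by
  refine LinearMap.ext fun x => ?_
  induction x using O.coinv_induction with
  | cls n a => exact h n a
  | add x y hx hy => rw [map_add, map_add, hx, hy]

/-- The bilinear map on coinvariants induced by invariant bilinear maps. -/
noncomputable def coinvLift₂ (f : ∀ n m, O.obj (Fin n) →ₗ[k] O.obj (Fin m) →ₗ[k] X)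
    (hf : ∀ n m, ∀ σ ∈ H n, ∀ a b, f n m (O.map σ a) b = f n m a b)
    (hf' : ∀ n m, ∀ σ ∈ H m, ∀ a b, f n m a (O.map σ b) = f n m a b) :
    O.Coinv H →ₗ[k] O.Coinv H →ₗ[k] X :=
  O.coinvLift
    (fun n =>
      { toFun := fun a => O.coinvLift (fun m => f n m a) fun m σ hσ b => hf' n m σ hσ a b
        map_add' := fun a b => O.coinv_hom_ext fun m c => by
          simp only [coinvLift_cls, LinearMap.add_apply, map_add]
        map_smul' := fun r a => O.coinv_hom_ext fun m c => by
          simp only [coinvLift_cls, LinearMap.smul_apply, map_smul, RingHom.id_apply] })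
    fun n σ hσ a => O.coinv_hom_ext fun m b => by
      simp only [LinearMap.coe_mk, AddHom.coe_mk, coinvLift_cls, hf n m σ hσ]

theorem coinvLift₂_cls (f : ∀ n m, O.obj (Fin n) →ₗ[k] O.obj (Fin m) →ₗ[k] X)
    (hf : ∀ n m, ∀ σ ∈ H n, ∀ a b, f n m (O.map σ a) b = f n m a b)
    (hf' : ∀ n m, ∀ σ ∈ H m, ∀ a b, f n m a (O.map σ b) = f n m a b) (n m : ℕ) (a : O.obj (Fin n))
    (b : O.obj (Fin m)) : O.coinvLift₂ f hf hf' (O.cls H n a) (O.cls H m b) = f n m a b := by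
  simp only [coinvLift₂, coinvLift_cls, LinearMap.coe_mk, AddHom.coe_mk]

end lift

variable (H) in
/-- The operator on coinvariants that multiplies elements of degree `d` by `c d`. -/
noncomputable def scaleCoinv (c : ℤ → k) : O.Coinv H →ₗ[k] O.Coinv H :=
  O.coinvLift (fun n => O.cls H n ∘ₗ O.scale (Fin n) c) fun n σ hσ a => by
    rw [LinearMap.comp_apply, scale_map, O.cls_map hσ, LinearMap.comp_apply]

theorem scaleCoinv_of_mem (c : ℤ → k) {d : ℤ} {x : O.Coinv H} (hx : x ∈ O.degPart H d) :
    O.scaleCoinv H c x = c d • x := by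
  refine O.degPart_induction (p := fun x => O.scaleCoinv H c x = c d • x)
    (fun n γ a ha => ?_) (fun x y hx hy => ?_) hx
  · rw [scaleCoinv, coinvLift_cls, LinearMap.comp_apply, O.scale_of_mem c ha, map_smul]
  · rw [map_add, hx, hy, smul_add]

-- Relabelling preserves degrees, so operators scaling each degree descend to the coinvariants;
-- those attached to the indicator functions of single degrees are the projections.
variable (H) in
theorem degPart_isInternal : DirectSum.IsInternal (O.degPart H) := by
  refine DirectSum.isInternal_of_projections _ ?_
    (fun d => O.scaleCoinv H fun e => if e = d then 1 else 0) ?_ ?_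
  · rw [eq_top_iff]
    rintro x -
    induction x using O.coinv_induction with
    | add x y hx hy => exact add_mem hx hy
    | cls n a =>
      induction a using O.obj_induction with
      | add a b ha hb => rw [map_add]; exact add_mem ha hb
      | hom γ d a ha => exact Submodule.mem_iSup_of_mem d (O.cls_mem_degPart ha)
  · intro d x hx
    rw [O.scaleCoinv_of_mem _ hx, if_pos rfl, one_smul]
  · intro d e hde x hx
    rw [O.scaleCoinv_of_mem _ hx, if_neg hde.symm, zero_smul]

variable (H) in
/-- The operator `(-1) ^ d` on elements of degree `d`. -/
noncomputable def parity : O.Coinv H →ₗ[k] O.Coinv H :=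
  O.scaleCoinv H (parityScalar k)

theorem parity_of_mem {d : ℤ} {x : O.Coinv H} (hx : x ∈ O.degPart H d) :
    O.parity H x = d.negOnePow • x := by
  rw [parity, O.scaleCoinv_of_mem _ hx, parityScalar_smul]

/-! ### Classes in the full coinvariants -/

section full

variable {S T : Type} [Finite S] [Finite T]

/-- Two enumerations differ by a permutation, which acts trivially on the full coinvariants. -/
theorem fullCls_eq_cls {n : ℕ} (e : S ≃ Fin n) (a : O.obj S) :
    O.fullCls S a = O.cls fullGroups n (O.map e a) := by
  obtain rfl : Nat.card S = n := by rw [Nat.card_congr e, Nat.card_fin]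
  rw [fullCls, LinearMap.comp_apply,
    ← O.cls_map (H := fullGroups) (σ := (Finite.equivFin S).symm.trans e) (Subgroup.mem_top _),
    ← O.map_trans]
  congr 3
  exact Equiv.ext fun x => by simp

theorem fullCls_map (f : S ≃ T) (a : O.obj S) : O.fullCls T (O.map f a) = O.fullCls S a := by
  rw [O.fullCls_eq_cls (f.trans (Finite.equivFin T)) a, O.fullCls_eq_cls (Finite.equivFin T),
    O.map_trans]

theorem fullCls_fin (n : ℕ) (a : O.obj (Fin n)) :
    O.fullCls (Fin n) a = O.cls fullGroups n a := by
  rw [O.fullCls_eq_cls (Equiv.refl _), O.map_refl]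

theorem fullCls_mem_degPart {γ d : ℤ} {a : O.obj S} (ha : a ∈ O.gr S γ d) :
    O.fullCls S a ∈ O.degPart fullGroups d :=
  O.cls_mem_degPart (O.map_mem _ ha)

end full

end NCKModularOperad

/-- Used to extract the bijection of the surviving flags from a bijection of all flags that respects
the contracted pairs. -/
theorem exists_equiv_of_isLeft_eq {A B P Q : Type} (e : A ⊕ P ≃ B ⊕ Q)
    (h : ∀ z, (e z).isLeft = z.isLeft) : ∃ g : A ≃ B, ∀ a, e (Sum.inl a) = Sum.inl (g a) := by
  have h1 : ∀ a, ∃ b, e (Sum.inl a) = Sum.inl b := fun a => Sum.isLeft_iff.1 (h _)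
  have h2 : ∀ b, ∃ a, e (Sum.inl a) = Sum.inl b := fun b => by
    have h3 := h (e.symm (Sum.inl b))
    rw [Equiv.apply_symm_apply] at h3
    obtain ⟨a, ha⟩ := Sum.isLeft_iff.1 h3.symm
    exact ⟨a, by rw [← ha, Equiv.apply_symm_apply]⟩
  choose g hg using h1
  refine ⟨Equiv.ofBijective g ⟨fun a a' haa' => ?_, fun b => ?_⟩, hg⟩
  · have : e (Sum.inl a) = e (Sum.inl a') := by rw [hg, hg, haa']
    exact Sum.inl_injective (e.injective this)
  · obtain ⟨a, ha⟩ := h2 b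
    exact ⟨a, Sum.inl_injective ((hg a).symm.trans ha)⟩

theorem Fintype.sum_subtype_eq_sum_dite {S M : Type*} [Fintype S] [AddCommMonoid M] (p : S → Prop)
    [DecidablePred p] (f : {x // p x} → M) :
    ∑ y, f y = ∑ x, if h : p x then f ⟨x, h⟩ else 0 := by
  rw [← Fintype.sum_subtype_add_sum_subtype p fun x => if h : p x then f ⟨x, h⟩ else 0]
  rw [Finset.sum_eq_zero (s := (Finset.univ : Finset {x // ¬ p x})) fun y _ => dif_neg y.2,
    add_zero]
  exact Finset.sum_congr rfl fun y _ => by rw [dif_pos y.2]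

/-! ### Classes of self-gluings, indexed by ordered pairs of flags. -/

namespace NCKModularOperad

section pairs

variable {S T : Type}

theorem selfGluePair_isLeft (s s' : S) (h : s ≠ s') (x : S) :
    (selfGluePair s s' h x).isLeft = true ↔ x ≠ s ∧ x ≠ s' := by
  simp only [selfGluePair, NCGraph.loop, Equiv.trans_apply, Equiv.apply_symm_apply, Equiv.coe_fn_mk]
  split_ifs with h1 h2
  · simp [h1]
  · simp [h2]
  · simp [h1, h2]

theorem selfGluePair_of_ne (s s' : S) (h : s ≠ s') (x : S) (hx : x ≠ s ∧ x ≠ s') :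
    selfGluePair s s' h x = Sum.inl ⟨x, hx⟩ := by
  simp only [selfGluePair, NCGraph.loop, Equiv.trans_apply, Equiv.apply_symm_apply, Equiv.coe_fn_mk]
  rw [dif_neg hx.1, dif_neg hx.2]

theorem selfGluePair_eq_inl {s s' : S} {h : s ≠ s'} {x : S} {y : {x : S // x ≠ s ∧ x ≠ s'}}
    (hx : selfGluePair s s' h x = Sum.inl y) : x = y.1 :=
  (selfGluePair s s' h).injective (hx.trans (selfGluePair_of_ne s s' h y.1 y.2).symm)

theorem selfGluePair_eq_inr {s s' : S} {h : s ≠ s'} {x : S} :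
    (∃ p, selfGluePair s s' h x = Sum.inr p) ↔ x = s ∨ x = s' := by
  rw [← Sum.isRight_iff, ← Sum.isLeft_eq_false, ← Bool.not_eq_true, selfGluePair_isLeft]
  tauto

theorem gluePair_inl_self (s : S) (t : T) :
    gluePair s t (Sum.inl s) = Sum.inr ((), false) := by
  classical
  change (dite (s = s) _ _ : _ ⊕ _) = _
  rw [dif_pos rfl]

theorem gluePair_inr_self (s : S) (t : T) :
    gluePair s t (Sum.inr t) = Sum.inr ((), true) := by
  classical
  change (dite (t = t) _ _ : _ ⊕ _) = _
  rw [dif_pos rfl]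

theorem gluePair_inl_of_ne (s : S) (t : T) {x : S} (h : x ≠ s) :
    gluePair s t (Sum.inl x) = Sum.inl (Sum.inl ⟨x, h⟩) := by
  classical
  change (dite (x = s) _ _ : _ ⊕ _) = _
  rw [dif_neg h]

theorem gluePair_inr_of_ne (s : S) (t : T) {x : T} (h : x ≠ t) :
    gluePair s t (Sum.inr x) = Sum.inl (Sum.inr ⟨x, h⟩) := by
  classical
  change (dite (x = t) _ _ : _ ⊕ _) = _
  rw [dif_neg h]

end pairs

variable {k : Type u} [Field k] {w : ℤˣ} (O : NCKModularOperad.{u, v} k w)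
variable {S T U : Type} [Finite S] [Finite T] [Finite U]

theorem fullCls_contr_map {S' T' : Type} [Finite S'] [Finite T'] (f : S ≃ S')
    (φ : S ≃ T ⊕ (Unit × Bool)) (φ' : S' ≃ T' ⊕ (Unit × Bool))
    (h : ∀ x, (φ' (f x)).isLeft = (φ x).isLeft) (a : O.obj S) :
    O.fullCls T' (O.contr φ' (O.map f a)) = O.fullCls T (O.contr φ a) := by
  obtain ⟨g, hg⟩ := exists_equiv_of_isLeft_eq ((φ.symm.trans f).trans φ') fun z => by
    simp only [Equiv.trans_apply]
    rw [h, Equiv.apply_symm_apply]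
  rw [O.contr_map f g φ φ', fullCls_map]
  · intro x t hx
    rw [← hg, Equiv.trans_apply, Equiv.trans_apply, ← hx, Equiv.symm_apply_apply]
  · intro x p hx
    apply Sum.isRight_iff.1
    rw [← Sum.isLeft_eq_false, h, hx]
    rfl

open Classical in
/-- The class of the self-gluing of the flags `s` and `s'`, zero if they coincide. -/
noncomputable def selfGlueCls (s s' : S) : O.obj S →ₗ[k] O.FullCoinv :=
  if h : s ≠ s' then O.fullCls _ ∘ₗ O.contr (selfGluePair s s' h) else 0

theorem selfGlueCls_self (s : S) : O.selfGlueCls s s = 0 :=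
  dif_neg fun h => h rfl

theorem selfGlueCls_of_ne {s s' : S} (h : s ≠ s') (a : O.obj S) :
    O.selfGlueCls s s' a = O.fullCls _ (O.contr (selfGluePair s s' h) a) := by
  rw [selfGlueCls, dif_pos h]
  rfl

/-- The enumeration of the surviving flags and the direction of the edge are both invisible in the
full coinvariants, so the contracted pair determines the class. -/
theorem fullCls_contr (φ : S ≃ T ⊕ (Unit × Bool)) {s s' : S} (h : s ≠ s')
    (hs : (φ s).isLeft = false) (hs' : (φ s').isLeft = false) (a : O.obj S) :
    O.fullCls T (O.contr φ a) = O.selfGlueCls s s' a := by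
  rw [O.selfGlueCls_of_ne h]
  conv_rhs => rw [← O.map_refl a]
  refine (O.fullCls_contr_map _ _ _ (fun x => ?_) a).symm
  rw [Bool.eq_iff_iff, Equiv.refl_apply, selfGluePair_isLeft]
  constructor
  · rintro ⟨h1, h2⟩
    by_contra hx
    simp only [Sum.not_isLeft, Sum.isLeft_eq_false, Sum.isRight_iff] at hs hs' hx
    obtain ⟨⟨⟨⟩, p⟩, hp⟩ := hs
    obtain ⟨⟨⟨⟩, q⟩, hq⟩ := hs'
    obtain ⟨⟨⟨⟩, r⟩, hr⟩ := hx
    -- Pigeonhole: a third contracted flag would need a third value in `Bool`.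
    have h3 : r ≠ p := fun e => h1 (φ.injective (by rw [hp, hr, e]))
    have h4 : r ≠ q := fun e => h2 (φ.injective (by rw [hq, hr, e]))
    have h5 : p ≠ q := fun e => h (φ.injective (by rw [hp, hq, e]))
    revert h3 h4 h5
    cases p <;> cases q <;> cases r <;> decide
  · intro hx
    constructor <;> rintro rfl
    · rw [hs] at hx; cases hx
    · rw [hs'] at hx; cases hx

theorem selfGlueCls_map {S' : Type} [Finite S'] (f : S ≃ S') (s s' : S) (a : O.obj S) :
    O.selfGlueCls (f s) (f s') (O.map f a) = O.selfGlueCls s s' a := by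
  by_cases h : s = s'
  · subst h
    rw [selfGlueCls_self, selfGlueCls_self, LinearMap.zero_apply, LinearMap.zero_apply]
  · have h' : f s ≠ f s' := fun e => h (f.injective e)
    rw [O.selfGlueCls_of_ne h', O.selfGlueCls_of_ne h]
    refine O.fullCls_contr_map _ _ _ (fun x => ?_) a
    rw [Bool.eq_iff_iff, selfGluePair_isLeft, selfGluePair_isLeft]
    simp

theorem selfGlueCls_symm (s s' : S) (a : O.obj S) :
    O.selfGlueCls s s' a = O.selfGlueCls s' s a := by
  by_cases h : s = s'
  · rw [h]
  · rw [O.selfGlueCls_of_ne h]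
    apply O.fullCls_contr _ (Ne.symm h)
    · rw [← Bool.not_eq_true, selfGluePair_isLeft]; simp
    · rw [← Bool.not_eq_true, selfGluePair_isLeft]; simp

/-! ### The multiplication -/

/-- The multiplication `[a] [b] = [a ⊟ b]`. -/
noncomputable def fullMul : O.FullCoinv →ₗ[k] O.FullCoinv →ₗ[k] O.FullCoinv :=
  O.coinvLift₂ (fun _ _ => O.hmulₗ.compr₂ (O.fullCls _))
    (fun n m σ _ a b => by
      have h := O.hmul_map σ (Equiv.refl _) a b
      rw [O.map_refl] at h
      rw [LinearMap.compr₂_apply, h, fullCls_map, LinearMap.compr₂_apply])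
    (fun n m σ _ a b => by
      have h := O.hmul_map (Equiv.refl _) σ a b
      rw [O.map_refl] at h
      rw [LinearMap.compr₂_apply, h, fullCls_map, LinearMap.compr₂_apply])

theorem fullMul_fullCls (a : O.obj S) (b : O.obj T) :
    O.fullMul (O.fullCls S a) (O.fullCls T b) = O.fullCls (S ⊕ T) (O.hmulₗ a b) := by
  rw [O.fullCls_eq_cls (Finite.equivFin S), O.fullCls_eq_cls (Finite.equivFin T), fullMul,
    coinvLift₂_cls, LinearMap.compr₂_apply, O.hmul_map, fullCls_map]

theorem full_induction {p : O.FullCoinv → Prop}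
    (cls : ∀ n γ d (a : O.obj (Fin n)), a ∈ O.gr (Fin n) γ d → p (O.fullCls (Fin n) a))
    (add : ∀ x y, p x → p y → p (x + y)) (x : O.FullCoinv) : p x := by
  induction x using O.coinv_induction with
  | add x y hx hy => exact add x y hx hy
  | cls n a =>
    rw [← fullCls_fin]
    induction a using O.obj_induction with
    | add a b ha hb => rw [map_add]; exact add _ _ ha hb
    | hom γ d a ha => exact cls n γ d a ha

theorem full_degPart_induction {d : ℤ} {p : O.FullCoinv → Prop}
    (cls : ∀ n γ (a : O.obj (Fin n)), a ∈ O.gr (Fin n) γ d → p (O.fullCls (Fin n) a))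
    (add : ∀ x y, p x → p y → p (x + y)) {x : O.FullCoinv} (hx : x ∈ O.degPart fullGroups d) :
    p x :=
  O.degPart_induction (fun n γ a ha => O.fullCls_fin n a ▸ cls n γ a ha) add hx

theorem fullMul_assoc (x y z : O.FullCoinv) :
    O.fullMul (O.fullMul x y) z = O.fullMul x (O.fullMul y z) := by
  induction x using O.full_induction with
  | add x x' h h' => simp only [map_add, LinearMap.add_apply, h, h']
  | cls n γ d a ha =>
  induction y using O.full_induction with
  | add x x' h h' => simp only [map_add, LinearMap.add_apply, h, h']
  | cls m γ' d' b hb =>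
  induction z using O.full_induction with
  | add x x' h h' => simp only [map_add, h, h']
  | cls l γ'' d'' c hc =>
    rw [fullMul_fullCls, fullMul_fullCls, fullMul_fullCls, fullMul_fullCls, hmul_assoc, fullCls_map]

theorem fullMul_comm {i j : ℤ} {x y : O.FullCoinv} (hx : x ∈ O.degPart fullGroups i)
    (hy : y ∈ O.degPart fullGroups j) : O.fullMul x y = (i * j).negOnePow • O.fullMul y x := by
  refine O.full_degPart_induction
    (p := fun x => O.fullMul x y = (i * j).negOnePow • O.fullMul y x) (fun n γ a ha => ?_)
    (fun x x' h h' => by simp only [map_add, LinearMap.add_apply, h, h', smul_add]) hx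
  refine O.full_degPart_induction
    (p := fun y => O.fullMul _ y = (i * j).negOnePow • O.fullMul y _) (fun m γ' b hb => ?_)
    (fun x x' h h' => by simp only [map_add, LinearMap.add_apply, h, h', smul_add]) hy
  rw [fullMul_fullCls, fullMul_fullCls, O.hmul_comm hb ha, map_sign_smul, fullCls_map, mul_comm]

theorem fullMul_mem {i j : ℤ} {x y : O.FullCoinv} (hx : x ∈ O.degPart fullGroups i)
    (hy : y ∈ O.degPart fullGroups j) : O.fullMul x y ∈ O.degPart fullGroups (i + j) := by
  refine O.full_degPart_induction
    (p := fun x => O.fullMul x y ∈ O.degPart fullGroups (i + j)) (fun n γ a ha => ?_)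
    (fun x x' h h' => by rw [map_add]; exact add_mem h h') hx
  refine O.full_degPart_induction
    (p := fun y => O.fullMul _ y ∈ O.degPart fullGroups (i + j)) (fun m γ' b hb => ?_)
    (fun x x' h h' => by rw [map_add]; exact add_mem h h') hy
  rw [fullMul_fullCls]
  exact O.fullCls_mem_degPart (O.hmul_mem ha hb)

theorem selfGlueCls_inl_inl (s s' : S) (a : O.obj S) (b : O.obj T) :
    O.selfGlueCls (Sum.inl s) (Sum.inl s') (O.hmulₗ a b) =
      O.fullMul (O.selfGlueCls s s' a) (O.fullCls T b) := by
  by_cases h : s = s'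
  · subst h
    simp only [selfGlueCls_self, LinearMap.zero_apply, map_zero]
  · rw [O.selfGlueCls_of_ne h, fullMul_fullCls, hmul_contr_left]
    refine (O.fullCls_contr _ (fun e => h (Sum.inl_injective e)) ?_ ?_ _).symm
    · have h1 : (selfGluePair s s' h s).isLeft = false := by
        rw [← Bool.not_eq_true, selfGluePair_isLeft]; simp
      obtain ⟨p, hp⟩ := Sum.isRight_iff.1 (Sum.isLeft_eq_false.1 h1)
      simp [extendRight, hp]
    · have h1 : (selfGluePair s s' h s').isLeft = false := by
        rw [← Bool.not_eq_true, selfGluePair_isLeft]; simp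
      obtain ⟨p, hp⟩ := Sum.isRight_iff.1 (Sum.isLeft_eq_false.1 h1)
      simp [extendRight, hp]

theorem selfGlueCls_inr_inr (t t' : T) {γ d : ℤ} {a : O.obj S} (ha : a ∈ O.gr S γ d)
    (b : O.obj T) :
    O.selfGlueCls (Sum.inr t) (Sum.inr t') (O.hmulₗ a b) =
      d.negOnePow • O.fullMul (O.fullCls S a) (O.selfGlueCls t t' b) := by
  by_cases h : t = t'
  · subst h
    simp only [selfGlueCls_self, LinearMap.zero_apply, map_zero, smul_zero]
  · rw [O.selfGlueCls_of_ne h, fullMul_fullCls, O.hmul_contr_right _ ha, map_sign_smul, smul_smul,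
      ← Int.negOnePow_add, Int.negOnePow_even _ ⟨d, rfl⟩, one_smul]
    refine (O.fullCls_contr _ (fun e => h (Sum.inr_injective e)) ?_ ?_ _).symm
    · have h1 : (selfGluePair t t' h t).isLeft = false := by
        rw [← Bool.not_eq_true, selfGluePair_isLeft]; simp
      obtain ⟨p, hp⟩ := Sum.isRight_iff.1 (Sum.isLeft_eq_false.1 h1)
      simp [extendLeft, hp]
    · have h1 : (selfGluePair t t' h t').isLeft = false := by
        rw [← Bool.not_eq_true, selfGluePair_isLeft]; simp
      obtain ⟨p, hp⟩ := Sum.isRight_iff.1 (Sum.isLeft_eq_false.1 h1)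
      simp [extendLeft, hp]

theorem fullCls_glue (s : S) (t : T) (a : O.obj S) (b : O.obj T) :
    O.fullCls _ (O.glue s t a b) = O.selfGlueCls (Sum.inl s) (Sum.inr t) (O.hmulₗ a b) := by
  rw [glue_eq]
  apply O.fullCls_contr _ (by simp)
  · rw [gluePair_inl_self]; rfl
  · rw [gluePair_inr_self]; rfl

/-! ### The BV operator -/

/-- The sum over all the self-gluings. -/
noncomputable def fullDelta : O.FullCoinv →ₗ[k] O.FullCoinv :=
  -- Summing over ordered pairs, diagonal included, makes invariance a mere reindexing; the factor
  -- one half corrects for counting each pair twice.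
  O.coinvLift (fun n => (2 : k)⁻¹ • ∑ s : Fin n, ∑ s' : Fin n, O.selfGlueCls s s')
    (fun n σ _ a => by
      simp only [LinearMap.smul_apply, LinearMap.sum_apply]
      congr 1
      rw [← Equiv.sum_comp σ]
      refine Finset.sum_congr rfl fun s _ => ?_
      rw [← Equiv.sum_comp σ]
      exact Finset.sum_congr rfl fun s' _ => O.selfGlueCls_map σ s s' a)

theorem fullDelta_fullCls {S : Type} [Fintype S] (a : O.obj S) :
    O.fullDelta (O.fullCls S a) = (2 : k)⁻¹ • ∑ s : S, ∑ s' : S, O.selfGlueCls s s' a := by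
  rw [O.fullCls_eq_cls (Finite.equivFin S), fullDelta, coinvLift_cls]
  simp only [LinearMap.smul_apply, LinearMap.sum_apply]
  congr 1
  rw [← Equiv.sum_comp (Finite.equivFin S)]
  refine Finset.sum_congr rfl fun s _ => ?_
  rw [← Equiv.sum_comp (Finite.equivFin S)]
  exact Finset.sum_congr rfl fun s' _ => O.selfGlueCls_map _ s s' a

theorem selfGlueCls_mem (s s' : S) {γ d : ℤ} {a : O.obj S} (ha : a ∈ O.gr S γ d) :
    O.selfGlueCls s s' a ∈ O.degPart fullGroups (d + w) := by
  by_cases h : s = s'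
  · rw [h, selfGlueCls_self]
    exact zero_mem _
  · rw [O.selfGlueCls_of_ne h]
    exact O.fullCls_mem_degPart (O.contr_mem _ ha)

theorem fullDelta_mem {i : ℤ} {x : O.FullCoinv} (hx : x ∈ O.degPart fullGroups i) :
    O.fullDelta x ∈ O.degPart fullGroups (i + w) := by
  refine O.full_degPart_induction
    (p := fun x => O.fullDelta x ∈ O.degPart fullGroups (i + w)) (fun n γ a ha => ?_)
    (fun x x' h h' => by rw [map_add]; exact add_mem h h') hx
  rw [fullDelta_fullCls]
  exact Submodule.smul_mem _ _ (sum_mem fun s _ => sum_mem fun s' _ => O.selfGlueCls_mem s s' ha)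

theorem isSelfGluingOperator_fullDelta [CharZero k] : O.IsSelfGluingOperator O.fullDelta := by
  intro S _ _ a
  have h1 : ∀ p : {p : S × S // p.1 < p.2},
      O.fullCls _ (O.selfGlue p.1.1 p.1.2 p.2.ne a) = O.selfGlueCls p.1.1 p.1.2 a :=
    fun p => (O.selfGlueCls_of_ne p.2.ne a).symm
  rw [fullDelta_fullCls, Finset.sum_congr rfl fun p _ => h1 p,
    Fintype.sum_subtype_eq_sum_dite (fun p : S × S => p.1 < p.2)
      fun p => O.selfGlueCls p.1.1 p.1.2 a, Fintype.sum_prod_type]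
  -- The diagonal terms vanish, and by symmetry the pairs above and below the diagonal contribute
  -- equally.
  have h2 : ∀ s s' : S, O.selfGlueCls s s' a =
      (if s < s' then O.selfGlueCls s s' a else 0) +
        if s' < s then O.selfGlueCls s' s a else 0 := by
    intro s s'
    rcases lt_trichotomy s s' with h | h | h
    · rw [if_pos h, if_neg h.not_gt, add_zero]
    · subst h
      simp [selfGlueCls_self]
    · rw [if_pos h, if_neg h.not_gt, zero_add, selfGlueCls_symm]
  rw [Finset.sum_congr rfl fun s _ => Finset.sum_congr rfl fun s' _ => h2 s s']
  simp only [Finset.sum_add_distrib]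
  rw [Finset.sum_comm (f := fun s s' : S => if s' < s then O.selfGlueCls s' s a else 0),
    ← two_smul k, smul_smul, inv_mul_cancel₀ two_ne_zero, one_smul]
  rfl

open Classical in
/-- The class of two successive self-gluings, zero if the flags are not distinct. -/
noncomputable def selfGlueCls₂ (s s' t t' : S) (a : O.obj S) : O.FullCoinv :=
  if h : s ≠ s' ∧ (t ≠ s ∧ t ≠ s') ∧ (t' ≠ s ∧ t' ≠ s') then
    O.selfGlueCls (S := {x // x ≠ s ∧ x ≠ s'}) ⟨t, h.2.1⟩ ⟨t', h.2.2⟩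
      (O.contr (selfGluePair s s' h.1) a)
  else 0

/-- This is `contr_contr` on the level of classes. When flags coincide both sides are zero, which is
what allows unrestricted sums in `fullDelta_sq`. -/
theorem selfGlueCls₂_swap (s s' t t' : S) (a : O.obj S) :
    O.selfGlueCls₂ s s' t t' a = -O.selfGlueCls₂ t t' s s' a := by
  by_cases h : s ≠ s' ∧ (t ≠ s ∧ t ≠ s') ∧ (t' ≠ s ∧ t' ≠ s')
  swap
  · rw [selfGlueCls₂, dif_neg h, selfGlueCls₂, zero_eq_neg]
    split_ifs with h'
    · have : s = s' := by
        by_contra h1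
        exact h ⟨h1, ⟨h'.2.1.1.symm, h'.2.2.1.symm⟩, h'.2.1.2.symm, h'.2.2.2.symm⟩
      subst this
      rw [selfGlueCls_self, LinearMap.zero_apply]
    · rfl
  by_cases htt : t = t'
  · subst htt
    rw [selfGlueCls₂, dif_pos h, selfGlueCls_self, LinearMap.zero_apply, selfGlueCls₂, dif_neg,
      neg_zero]
    simp
  have h' : t ≠ t' ∧ (s ≠ t ∧ s ≠ t') ∧ (s' ≠ t ∧ s' ≠ t') :=
    ⟨htt, ⟨h.2.1.1.symm, h.2.2.1.symm⟩, h.2.1.2.symm, h.2.2.2.symm⟩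
  rw [selfGlueCls₂, dif_pos h, selfGlueCls₂, dif_pos h',
    O.selfGlueCls_of_ne (fun e => htt (congrArg Subtype.val e)),
    O.selfGlueCls_of_ne (fun e => h.1 (congrArg Subtype.val e))]
  conv_lhs => rw [← O.map_refl a]
  -- The same surviving flags, with the two pairs removed in the other order.
  let g : {y : {x // x ≠ t ∧ x ≠ t'} // y ≠ ⟨s, h'.2.1⟩ ∧ y ≠ ⟨s', h'.2.2⟩} ≃
      {y : {x // x ≠ s ∧ x ≠ s'} // y ≠ ⟨t, h.2.1⟩ ∧ y ≠ ⟨t', h.2.2⟩} :=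
    { toFun := fun y => ⟨⟨y.1.1, fun e => y.2.1 (Subtype.ext e), fun e => y.2.2 (Subtype.ext e)⟩,
        fun e => y.1.2.1 (congrArg Subtype.val e), fun e => y.1.2.2 (congrArg Subtype.val e)⟩
      invFun := fun y => ⟨⟨y.1.1, fun e => y.2.1 (Subtype.ext e), fun e => y.2.2 (Subtype.ext e)⟩,
        fun e => y.1.2.1 (congrArg Subtype.val e), fun e => y.1.2.2 (congrArg Subtype.val e)⟩
      left_inv := fun y => rfl
      right_inv := fun y => rfl }
  refine (congrArg (O.fullCls _) (O.contr_contr (Equiv.refl _) g (selfGluePair t t' h'.1)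
    (selfGluePair ⟨s, h'.2.1⟩ ⟨s', h'.2.2⟩ fun e => h.1 (congrArg Subtype.val e))
    (selfGluePair s s' h.1)
    (selfGluePair ⟨t, h.2.1⟩ ⟨t', h.2.2⟩ fun e => htt (congrArg Subtype.val e))
    ?_ ?_ ?_ a)).trans (by rw [map_neg, fullCls_map])
  · intro x y z hx hy
    obtain rfl := selfGluePair_eq_inl hx
    obtain rfl := selfGluePair_eq_inl hy
    exact ⟨_, selfGluePair_of_ne _ _ _ _ (g z).1.2, selfGluePair_of_ne _ _ _ _ (g z).2⟩
  · intro x y p hx hy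
    obtain rfl := selfGluePair_eq_inl hx
    refine selfGluePair_eq_inr.2 ?_
    rcases selfGluePair_eq_inr.1 ⟨p, hy⟩ with rfl | rfl
    exacts [Or.inl rfl, Or.inr rfl]
  · intro x p hx
    have hx' := selfGluePair_eq_inr.1 ⟨p, hx⟩
    have hx'' : x ≠ s ∧ x ≠ s' := by
      rcases hx' with rfl | rfl
      exacts [h.2.1, h.2.2]
    obtain ⟨p', hp'⟩ := (selfGluePair_eq_inr (x := (⟨x, hx''⟩ : {x // x ≠ s ∧ x ≠ s'}))
      (h := fun e => htt (congrArg Subtype.val e))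
      (s := ⟨t, h.2.1⟩) (s' := ⟨t', h.2.2⟩)).2 (by simpa [Subtype.ext_iff] using hx')
    exact ⟨_, p', selfGluePair_of_ne _ _ _ _ hx'', hp'⟩

/-- Up to a scalar, the square is a sum over two ordered pairs of flags that is antisymmetric in
these pairs. It equals its own negative, and 2 is invertible. -/
theorem fullDelta_sq [CharZero k] (x : O.FullCoinv) : O.fullDelta (O.fullDelta x) = 0 := by
  induction x using O.full_induction with
  | add x x' h h' => rw [map_add, map_add, h, h', add_zero]
  | cls n γ d a ha =>
    classical
    have h1 : ∀ s s' : Fin n, O.fullDelta (O.selfGlueCls s s' a) =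
        (2 : k)⁻¹ • ∑ t, ∑ t', O.selfGlueCls₂ s s' t t' a := by
      intro s s'
      by_cases h : s = s'
      · subst h
        simp [selfGlueCls_self, selfGlueCls₂]
      · rw [O.selfGlueCls_of_ne h, fullDelta_fullCls, Fintype.sum_subtype_eq_sum_dite]
        congr 1
        refine Finset.sum_congr rfl fun t _ => ?_
        split_ifs with ht
        · rw [Fintype.sum_subtype_eq_sum_dite]
          refine Finset.sum_congr rfl fun t' _ => ?_
          rw [selfGlueCls₂]
          split_ifs with h1 h2 h2
          · rfl
          · exact absurd ⟨h, ht, h1⟩ h2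
          · exact absurd h2.2.2 h1
          · rfl
        · refine (Finset.sum_eq_zero fun t' _ => ?_).symm
          exact dif_neg fun h2 => ht h2.2.1
    rw [fullDelta_fullCls]
    simp only [map_smul, map_sum, h1]
    simp only [← Finset.smul_sum]
    rw [smul_smul]
    refine smul_eq_zero_of_right _ ?_
    set F := ∑ s, ∑ s', ∑ t, ∑ t', O.selfGlueCls₂ s s' t t' a with hF
    have h2 : F = -F := by
      have h4 : F = ∑ p : Fin n × Fin n, ∑ q : Fin n × Fin n,
          O.selfGlueCls₂ p.1 p.2 q.1 q.2 a := by
        simp only [hF, Fintype.sum_prod_type]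
      have h5 : F = ∑ p : Fin n × Fin n, ∑ q : Fin n × Fin n,
          O.selfGlueCls₂ q.1 q.2 p.1 p.2 a := h4.trans Finset.sum_comm
      nth_rewrite 1 [h5]
      rw [h4, ← Finset.sum_neg_distrib]
      refine Finset.sum_congr rfl fun p _ => ?_
      rw [← Finset.sum_neg_distrib]
      exact Finset.sum_congr rfl fun q _ => O.selfGlueCls₂_swap _ _ _ _ a
    have h3 : (2 : k) • F = 0 := by
      rw [two_smul]; nth_rewrite 1 [h2]; exact neg_add_cancel F
    exact (smul_eq_zero.1 h3).resolve_left two_ne_zero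

end NCKModularOperad

namespace NCKModularOperad

variable {k : Type u} [Field k] {w : ℤˣ} (O : NCKModularOperad.{u, v} k w)

/-! ### The bracket on the full coinvariants -/

/-- The bracket induced by the BV operator. -/
noncomputable def fullBracket : O.FullCoinv →ₗ[k] O.FullCoinv →ₗ[k] O.FullCoinv :=
  (O.fullMul ∘ₗ O.parity fullGroups).compr₂ O.fullDelta - O.fullMul.compl₂ O.fullDelta -
    O.fullMul ∘ₗ O.fullDelta ∘ₗ O.parity fullGroups

theorem fullBracket_of_mem {i : ℤ} {x : O.FullCoinv} (hx : x ∈ O.degPart fullGroups i)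
    (y : O.FullCoinv) :
    O.fullBracket x y = i.negOnePow • O.fullDelta (O.fullMul x y) - O.fullMul x (O.fullDelta y) -
      i.negOnePow • O.fullMul (O.fullDelta x) y := by
  simp only [fullBracket, LinearMap.sub_apply, LinearMap.compr₂_apply, LinearMap.compl₂_apply,
    LinearMap.comp_apply, O.parity_of_mem hx, map_sign_smul, sign_smul_apply]

variable {S T : Type} [Fintype S] [Fintype T]

/-- A pair of flags of a ⊟ b lies in a, lies in b, or is mixed; the last sum measures the failure of
Δ to be a derivation. -/
theorem fullDelta_mul [CharZero k] {γ d : ℤ} {a : O.obj S} (ha : a ∈ O.gr S γ d) (b : O.obj T) :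
    O.fullDelta (O.fullMul (O.fullCls S a) (O.fullCls T b)) =
      O.fullMul (O.fullDelta (O.fullCls S a)) (O.fullCls T b) +
        d.negOnePow • O.fullMul (O.fullCls S a) (O.fullDelta (O.fullCls T b)) +
        ∑ s : S, ∑ t : T, O.selfGlueCls (Sum.inl s) (Sum.inr t) (O.hmulₗ a b) := by
  rw [fullMul_fullCls, fullDelta_fullCls, fullDelta_fullCls, fullDelta_fullCls]
  simp only [Fintype.sum_sum_type, selfGlueCls_inl_inl, O.selfGlueCls_inr_inr _ _ ha,
    Finset.sum_add_distrib, map_smul, map_sum, LinearMap.smul_apply, LinearMap.sum_apply,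
    ← Finset.smul_sum]
  have h : ∑ t : T, ∑ s : S, O.selfGlueCls (Sum.inr t) (Sum.inl s) (O.hmulₗ a b) =
      ∑ s : S, ∑ t : T, O.selfGlueCls (Sum.inl s) (Sum.inr t) (O.hmulₗ a b) := by
    rw [Finset.sum_comm]
    exact Finset.sum_congr rfl fun s _ => Finset.sum_congr rfl fun t _ => O.selfGlueCls_symm _ _ _
  rw [h]
  simp only [Units.smul_def, smul_add, smul_comm (2 : k)⁻¹ (d.negOnePow : ℤ)]
  generalize ∑ s : S, ∑ t : T, O.selfGlueCls (Sum.inl s) (Sum.inr t) (O.hmulₗ a b) = x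
  -- Each mixed pair occurs in both orders, which cancels the factor one half.
  have h2 : x = (2 : k)⁻¹ • x + (2 : k)⁻¹ • x := by
    rw [← add_smul, ← two_mul, mul_inv_cancel₀ two_ne_zero, one_smul]
  nth_rewrite 3 [h2]
  abel

/-- The correction terms in the induced bracket cancel the unmixed pairs of `fullDelta_mul`, and
only gluings between the two elements survive. -/
theorem fullBracket_fullCls [CharZero k] {γ d : ℤ} {a : O.obj S} (ha : a ∈ O.gr S γ d)
    (b : O.obj T) :
    O.fullBracket (O.fullCls S a) (O.fullCls T b) =
      d.negOnePow • ∑ s : S, ∑ t : T, O.selfGlueCls (Sum.inl s) (Sum.inr t) (O.hmulₗ a b) := by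
  rw [O.fullBracket_of_mem (O.fullCls_mem_degPart ha), O.fullDelta_mul ha, smul_add, smul_add,
    smul_smul, ← Int.negOnePow_add, Int.negOnePow_even _ ⟨d, rfl⟩, one_smul]
  abel

theorem isFullGluingBracket_fullBracket [CharZero k] : O.IsFullGluingBracket O.fullBracket := by
  intro S T _ _ γ d a b ha
  simp only [O.fullBracket_fullCls ha, fullCls_glue]

/-- The new edge starts at the first element and ends at one of the two factors. In the second case
the first element is moved past `y`, with sign `i * j`, and the edge is then moved past `y`, with
sign `j`. -/
theorem fullBracket_leibniz [CharZero k] {i j : ℤ} {x y : O.FullCoinv}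
    (hx : x ∈ O.degPart fullGroups i) (hy : y ∈ O.degPart fullGroups j) (z : O.FullCoinv) :
    O.fullBracket x (O.fullMul y z) =
      O.fullMul (O.fullBracket x y) z +
        ((i - 1) * j).negOnePow • O.fullMul y (O.fullBracket x z) := by
  refine O.full_degPart_induction
    (p := fun x => O.fullBracket x (O.fullMul y z) = O.fullMul (O.fullBracket x y) z +
        ((i - 1) * j).negOnePow • O.fullMul y (O.fullBracket x z)) (fun n γ a ha => ?_)
    (fun x x' h h' => by simp only [map_add, LinearMap.add_apply, h, h', smul_add]; abel) hx
  refine O.full_degPart_induction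
    (p := fun y => O.fullBracket _ (O.fullMul y z) = O.fullMul (O.fullBracket _ y) z +
        ((i - 1) * j).negOnePow • O.fullMul y (O.fullBracket _ z)) (fun m γ' b hb => ?_)
    (fun x x' h h' => by simp only [map_add, LinearMap.add_apply, h, h', smul_add]; abel) hy
  induction z using O.full_induction with
  | add x x' h h' => simp only [map_add, h, h', smul_add]; abel
  | cls l γ'' d c hc =>
    rw [fullMul_fullCls, O.fullBracket_fullCls ha, O.fullBracket_fullCls ha,
      O.fullBracket_fullCls ha]
    have h1 : ∀ (s : Fin n) (t : Fin m),
        O.selfGlueCls (Sum.inl s) (Sum.inr (Sum.inl t)) (O.hmulₗ a (O.hmulₗ b c)) =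
          O.fullMul (O.selfGlueCls (Sum.inl s) (Sum.inr t) (O.hmulₗ a b))
            (O.fullCls _ c) := fun s t => by
      rw [hmul_assoc, ← selfGlueCls_inl_inl]
      exact O.selfGlueCls_map (Equiv.sumAssoc _ _ _) (Sum.inl (Sum.inl s)) (Sum.inl (Sum.inr t)) _
    have h2 : ∀ (s : Fin n) (t : Fin l),
        O.selfGlueCls (Sum.inl s) (Sum.inr (Sum.inr t)) (O.hmulₗ a (O.hmulₗ b c)) =
          ((i - 1) * j).negOnePow • O.fullMul (O.fullCls _ b)
            (O.selfGlueCls (Sum.inl s) (Sum.inr t) (O.hmulₗ a c)) := fun s t => by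
      have h3 := O.selfGlueCls_inr_inr (Sum.inl s) (Sum.inr t) hb (O.hmulₗ a c)
      have h4 : O.fullMul (O.fullCls _ b)
          (O.selfGlueCls (Sum.inl s) (Sum.inr t) (O.hmulₗ a c)) = j.negOnePow •
          O.selfGlueCls (Sum.inr (Sum.inl s)) (Sum.inr (Sum.inr t)) (O.hmulₗ b (O.hmulₗ a c)) := by
        rw [h3, smul_smul, ← Int.negOnePow_add, Int.negOnePow_even _ ⟨j, rfl⟩, one_smul]
      have h5 := O.hmul_map (Equiv.sumComm _ _) (Equiv.refl _) (O.hmulₗ b a) c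
      rw [O.map_refl] at h5
      rw [h4, hmul_assoc, hmul_assoc, O.hmul_comm hb ha, map_sign_smul_left, h5, map_sign_smul,
        map_sign_smul, smul_smul, ← Int.negOnePow_add]
      refine congrArg₂ _ ?_ ?_
      · rw [Int.negOnePow_eq_iff]
        exact ⟨0, by ring⟩
      · rw [← O.map_trans]
        exact (O.selfGlueCls_map ((Equiv.sumCongr (Equiv.sumComm (Fin m) (Fin n))
          (Equiv.refl (Fin l))).trans (Equiv.sumAssoc _ _ _)) (Sum.inl (Sum.inr s)) (Sum.inr t)
          _).trans (O.selfGlueCls_map (Equiv.sumAssoc (Fin m) (Fin n) (Fin l))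
            (Sum.inl (Sum.inr s)) (Sum.inr t) _).symm
    simp only [Fintype.sum_sum_type, h1, h2, Finset.sum_add_distrib, map_sum, LinearMap.sum_apply,
      map_sign_smul, sign_smul_apply, smul_add, ← Finset.smul_sum]
    rw [smul_comm i.negOnePow ((i - 1) * j).negOnePow]

end NCKModularOperad

/-! ### Rotations -/

theorem finRotate_val {n : ℕ} (x : Fin n) : (finRotate n x).val = (x.val + 1) % n := by
  cases n with
  | zero => exact x.elim0
  | succ n => rw [finRotate_apply, Fin.val_add]; simp

theorem finRotate_pow_val {n : ℕ} (j : ℕ) (x : Fin n) :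
    ((finRotate n ^ j) x).val = (x.val + j) % n := by
  induction j with
  | zero => exact (Nat.mod_eq_of_lt x.isLt).symm
  | succ j ih =>
    rw [pow_succ', Equiv.Perm.mul_apply, finRotate_val, ih, Nat.mod_add_mod, add_assoc]

/-- The rotation by `j`. -/
def rotateEquiv {N N' : ℕ} (h : N = N') (j : ℕ) : Fin N ≃ Fin N' :=
  (finCongr h).trans (finRotate N' ^ j)

/-- At most one turn around the circle is ever needed; the disjunction replaces the remainder by
linear arithmetic within reach of `omega`. `cyclicEnum_cases` plays the same role. -/
theorem rotateEquiv_eq {N N' : ℕ} (h : N = N') (j : ℕ) (x : Fin N) (y : Fin N')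
    (hxy : x.val + j = y.val ∨ x.val + j = y.val + N') : y = rotateEquiv h j x := by
  apply Fin.ext
  rw [rotateEquiv, Equiv.trans_apply, finRotate_pow_val, finCongr_apply, Fin.val_cast]
  rcases hxy with e | e
  · rw [e, Nat.mod_eq_of_lt y.isLt]
  · rw [e, Nat.add_mod_right, Nat.mod_eq_of_lt y.isLt]

theorem cyclicEnum_val {n : ℕ} (s : Fin n) (x : {x : Fin n // x ≠ s}) :
    (cyclicEnum s x).val =
      if s.val < x.1.val then x.1.val - s.val - 1 else x.1.val + (n - 1 - s.val) := by
  have h1 := x.1.isLt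
  have h2 := s.isLt
  have h3 : x.1.val ≠ s.val := fun h => x.2 (Fin.ext h)
  change (x.1.val + (n - 1 - s.val)) % n = _
  split_ifs with h
  · rw [Nat.mod_eq_sub_mod (by omega), Nat.mod_eq_of_lt (by omega)]; omega
  · exact Nat.mod_eq_of_lt (by omega)

theorem cyclicEnum_cases {n : ℕ} {s x : Fin n} (h : x ≠ s) :
    (s.val < x.val ∧ (cyclicEnum s ⟨x, h⟩).val + s.val + 1 = x.val) ∨
      (x.val < s.val ∧ (cyclicEnum s ⟨x, h⟩).val + s.val + 1 = x.val + n) := by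
  have h2 := s.isLt
  have h3 : x.val ≠ s.val := fun h4 => h (Fin.ext h4)
  have h4 := cyclicEnum_val s ⟨x, h⟩
  simp only at h4
  split_ifs at h4 <;> omega

theorem cyclicSumEnum_inl_val {n m : ℕ} (s : Fin n) (t : Fin m) (x : {x : Fin n // x ≠ s}) :
    (cyclicSumEnum s t (Sum.inl x)).val = (cyclicEnum s x).val :=
  rfl

theorem cyclicSumEnum_inr_val {n m : ℕ} (s : Fin n) (t : Fin m) (x : {x : Fin m // x ≠ t}) :
    (cyclicSumEnum s t (Sum.inr x)).val = n - 1 + (cyclicEnum t x).val :=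
  rfl

/-- The enumeration counts from the removed flag, so only relative positions matter. -/
theorem cyclicEnum_finRotate {n : ℕ} (s x : Fin n) (h : x ≠ s) (h' : finRotate n x ≠ finRotate n s) :
    cyclicEnum (finRotate n s) ⟨finRotate n x, h'⟩ = cyclicEnum s ⟨x, h⟩ := by
  have h1 := x.isLt
  have h2 := s.isLt
  have h3 : x.val ≠ s.val := fun h4 => h (Fin.ext h4)
  have h4 : ∀ y : Fin n, (finRotate n y).val = if y.val + 1 = n then 0 else y.val + 1 := by
    intro y
    have h5 := y.isLt
    rw [finRotate_val]
    split_ifs with h6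
    · rw [h6, Nat.mod_self]
    · exact Nat.mod_eq_of_lt (by omega)
  apply Fin.ext
  rw [cyclicEnum_val, cyclicEnum_val]
  simp only [h4]
  split_ifs <;> omega

theorem Finset.sum_rearrange {α β γ δ M : Type*} [Fintype α] [Fintype β] [Fintype γ] [Fintype δ]
    [AddCommMonoid M] (f : α → β → γ → δ → M) :
    ∑ t, ∑ u, ∑ s, ∑ t', f s t' u t = ∑ s, ∑ t', ∑ u, ∑ t, f s t' u t := by
  calc ∑ t, ∑ u, ∑ s, ∑ t', f s t' u t
      = ∑ t, ∑ s, ∑ u, ∑ t', f s t' u t :=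
        Finset.sum_congr rfl fun _ _ => Finset.sum_comm
    _ = ∑ s, ∑ t, ∑ u, ∑ t', f s t' u t := Finset.sum_comm
    _ = ∑ s, ∑ t, ∑ t', ∑ u, f s t' u t :=
        Finset.sum_congr rfl fun _ _ => Finset.sum_congr rfl fun _ _ => Finset.sum_comm
    _ = ∑ s, ∑ t', ∑ t, ∑ u, f s t' u t :=
        Finset.sum_congr rfl fun _ _ => Finset.sum_comm
    _ = ∑ s, ∑ t', ∑ u, ∑ t, f s t' u t :=
        Finset.sum_congr rfl fun _ _ => Finset.sum_congr rfl fun _ _ => Finset.sum_comm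

theorem extendLeft_inl {S T U : Type} (φ : S ≃ T ⊕ (Unit × Bool)) (x : U) :
    extendLeft U φ (Sum.inl x) = Sum.inl (Sum.inl x) :=
  rfl

theorem extendLeft_inr_inl {S T U : Type} {φ : S ≃ T ⊕ (Unit × Bool)} {x : S} {t : T}
    (h : φ x = Sum.inl t) : extendLeft U φ (Sum.inr x) = Sum.inl (Sum.inr t) := by
  simp [extendLeft, h]

theorem extendLeft_inr_inr {S T U : Type} {φ : S ≃ T ⊕ (Unit × Bool)} {x : S} {p : Unit × Bool}
    (h : φ x = Sum.inr p) : extendLeft U φ (Sum.inr x) = Sum.inr p := by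
  simp [extendLeft, h]

/-! ### Gluing in the cyclic coinvariants. -/

namespace NCKModularOperad

/-- The two flags to be glued, and the other ones in their cyclic order. -/
noncomputable def cycPair {n m : ℕ} (s : Fin n) (t : Fin m) :
    Fin n ⊕ Fin m ≃ Fin ((n - 1) + (m - 1)) ⊕ (Unit × Bool) :=
  (gluePair s t).trans (Equiv.sumCongr (cyclicSumEnum s t) (Equiv.refl _))

section pairs

variable {n m : ℕ} (s : Fin n) (t : Fin m)

theorem cycPair_inl_self : cycPair s t (Sum.inl s) = Sum.inr ((), false) := by
  rw [cycPair, Equiv.trans_apply, gluePair_inl_self]; rfl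

theorem cycPair_inr_self : cycPair s t (Sum.inr t) = Sum.inr ((), true) := by
  rw [cycPair, Equiv.trans_apply, gluePair_inr_self]; rfl

theorem cycPair_inl {x : Fin n} (h : x ≠ s) :
    cycPair s t (Sum.inl x) = Sum.inl (Fin.castAdd _ (cyclicEnum s ⟨x, h⟩)) := by
  rw [cycPair, Equiv.trans_apply, gluePair_inl_of_ne s t h]; rfl

theorem cycPair_inr {x : Fin m} (h : x ≠ t) :
    cycPair s t (Sum.inr x) = Sum.inl (Fin.natAdd _ (cyclicEnum t ⟨x, h⟩)) := by
  rw [cycPair, Equiv.trans_apply, gluePair_inr_of_ne s t h]; rfl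

end pairs

variable {k : Type u} [Field k] {w : ℤˣ} (O : NCKModularOperad.{u, v} k w)

theorem cls_rotateEquiv {N N' : ℕ} (h : N = N') (j : ℕ) (a : O.obj (Fin N)) :
    O.cls cyclicGroups N' (O.map (rotateEquiv h j) a) = O.cls cyclicGroups N a := by
  subst h
  exact O.cls_map (H := cyclicGroups) (Subgroup.pow_mem _ (Subgroup.mem_zpowers _) j) a

/-- The permutations that leave `f` invariant form a subgroup, so it suffices to test the generator.
-/
theorem cyclic_invariant {n : ℕ} {X : Type*} [AddCommGroup X] [Module k X]
    (f : O.obj (Fin n) →ₗ[k] X) (hf : ∀ a, f (O.map (finRotate n) a) = f a)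
    (σ : Equiv.Perm (Fin n)) (hσ : σ ∈ cyclicGroups n) (a : O.obj (Fin n)) :
    f (O.map σ a) = f a := by
  let K : Subgroup (Equiv.Perm (Fin n)) :=
    { carrier := {σ | ∀ a, f (O.map σ a) = f a}
      mul_mem' := fun {σ τ} hσ hτ a => by
        have h : O.map (σ * τ) a = O.map σ (O.map τ a) := O.map_trans τ σ a
        rw [h, hσ, hτ]
      one_mem' := fun a => congrArg f (O.map_refl a)
      inv_mem' := fun {σ} hσ a => by
        have h : O.map σ (O.map σ⁻¹ a) = a := by
          rw [← O.map_trans]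
          have : σ⁻¹.trans σ = Equiv.refl _ := Equiv.symm_trans_self σ
          rw [this, O.map_refl]
        rw [← hσ, h] }
  have h : cyclicGroups n ≤ K := by
    rw [cyclicGroups, Subgroup.zpowers_le]
    exact hf
  exact h hσ a

section cyclic

variable {n m l : ℕ}

/-- The class of a gluing in the cyclic coinvariants. -/
noncomputable def cycGlue (s : Fin n) (t : Fin m) :
    O.obj (Fin n) →ₗ[k] O.obj (Fin m) →ₗ[k] O.CyclicCoinv :=
  O.hmulₗ.compr₂ (O.cls cyclicGroups _ ∘ₗ O.contr (cycPair s t))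

theorem cycGlue_apply (s : Fin n) (t : Fin m) (a : O.obj (Fin n)) (b : O.obj (Fin m)) :
    O.cycGlue s t a b = O.cls cyclicGroups _ (O.contr (cycPair s t) (O.hmulₗ a b)) :=
  rfl

theorem cls_map_glue (s : Fin n) (t : Fin m) (a : O.obj (Fin n)) (b : O.obj (Fin m)) :
    O.cls cyclicGroups _ (O.map (cyclicSumEnum s t) (O.glue s t a b)) = O.cycGlue s t a b := by
  rw [glue_eq, cycGlue_apply, ← O.contr_map (Equiv.refl _) (cyclicSumEnum s t) (gluePair s t)
    (cycPair s t), O.map_refl]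
  · intro x r hx
    rw [cycPair, Equiv.refl_apply, Equiv.trans_apply, hx]; rfl
  · intro x p hx
    exact ⟨p, by rw [cycPair, Equiv.refl_apply, Equiv.trans_apply, hx]; rfl⟩

theorem cycGlue_rotate_left (s : Fin n) (t : Fin m) (a : O.obj (Fin n)) (b : O.obj (Fin m)) :
    O.cycGlue (finRotate n s) t (O.map (finRotate n) a) b = O.cycGlue s t a b := by
  have h := O.hmul_map (finRotate n) (Equiv.refl _) a b
  rw [O.map_refl] at h
  rw [cycGlue_apply, cycGlue_apply, h,
    O.contr_map _ (Equiv.refl _) (cycPair s t) (cycPair (finRotate n s) t), O.map_refl]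
  · rintro (x | x) r hx
    · by_cases hs : x = s
      · subst hs; rw [cycPair_inl_self] at hx; cases hx
      · have hs' : finRotate n x ≠ finRotate n s := fun e => hs ((finRotate n).injective e)
        rw [cycPair_inl _ _ hs] at hx
        cases hx
        exact (cycPair_inl _ _ hs').trans (by rw [cyclicEnum_finRotate s x hs hs']; rfl)
    · by_cases ht : x = t
      · subst ht; rw [cycPair_inr_self] at hx; cases hx
      · rw [cycPair_inr _ _ ht] at hx
        cases hx
        exact cycPair_inr _ _ ht
  · rintro (x | x) r hx
    · by_cases hs : x = s
      · subst hs
        exact ⟨_, cycPair_inl_self _ _⟩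
      · rw [cycPair_inl _ _ hs] at hx
        cases hx
    · by_cases ht : x = t
      · subst ht
        exact ⟨_, cycPair_inr_self _ _⟩
      · rw [cycPair_inr _ _ ht] at hx
        cases hx

/-- Exchanging the factors moves a block of `m - 1` flags from the end to the front. That is a
rotation, so it disappears in the cyclic coinvariants, and only the Koszul sign of `hmul_comm`
remains. -/
theorem cycGlue_comm (s : Fin n) (t : Fin m) {γ d γ' d' : ℤ} {a : O.obj (Fin n)}
    {b : O.obj (Fin m)} (ha : a ∈ O.gr (Fin n) γ d) (hb : b ∈ O.gr (Fin m) γ' d') :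
    O.cycGlue t s b a = (d * d').negOnePow • O.cycGlue s t a b := by
  rw [cycGlue_apply, cycGlue_apply, O.hmul_comm ha hb, map_sign_smul, map_sign_smul,
    O.contr_map _ (rotateEquiv (add_comm _ _) (m - 1)) (cycPair s t) (cycPair t s),
    cls_rotateEquiv]
  · rintro (x | x) r hx
    · by_cases hs : x = s
      · subst hs; rw [cycPair_inl_self] at hx; cases hx
      · rw [cycPair_inl _ _ hs] at hx
        cases hx
        refine (cycPair_inr _ _ hs).trans (congrArg Sum.inl (rotateEquiv_eq _ _ _ _ ?_))
        simp only [Fin.val_castAdd, Fin.val_natAdd]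
        omega
    · by_cases ht : x = t
      · subst ht; rw [cycPair_inr_self] at hx; cases hx
      · rw [cycPair_inr _ _ ht] at hx
        cases hx
        refine (cycPair_inl _ _ ht).trans (congrArg Sum.inl (rotateEquiv_eq _ _ _ _ ?_))
        simp only [Fin.val_castAdd, Fin.val_natAdd]
        omega
  · rintro (x | x) r hx
    · by_cases hs : x = s
      · subst hs
        exact ⟨_, cycPair_inr_self _ _⟩
      · rw [cycPair_inl _ _ hs] at hx
        cases hx
    · by_cases ht : x = t
      · subst ht
        exact ⟨_, cycPair_inl_self _ _⟩
      · rw [cycPair_inr _ _ ht] at hx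
        cases hx

theorem cycGlue_rotate_right (s : Fin n) (t : Fin m) (a : O.obj (Fin n)) (b : O.obj (Fin m)) :
    O.cycGlue s (finRotate m t) a (O.map (finRotate m) b) = O.cycGlue s t a b := by
  induction a using O.obj_induction with
  | add a a' h h' => simp only [map_add, LinearMap.add_apply, h, h']
  | hom γ d a ha =>
  induction b using O.obj_induction with
  | add b b' h h' => simp only [map_add, h, h']
  | hom γ' d' b hb =>
    rw [O.cycGlue_comm _ _ (O.map_mem _ hb) ha, cycGlue_rotate_left, O.cycGlue_comm _ _ hb ha]

/-- The sum over all the non-self gluings. -/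
noncomputable def cycSum (n m : ℕ) : O.obj (Fin n) →ₗ[k] O.obj (Fin m) →ₗ[k] O.CyclicCoinv :=
  ∑ s, ∑ t, O.cycGlue s t

theorem cycSum_apply (a : O.obj (Fin n)) (b : O.obj (Fin m)) :
    O.cycSum n m a b = ∑ s, ∑ t, O.cycGlue s t a b := by
  simp only [cycSum, LinearMap.sum_apply]

theorem cycSum_rotate_left (a : O.obj (Fin n)) (b : O.obj (Fin m)) :
    O.cycSum n m (O.map (finRotate n) a) b = O.cycSum n m a b := by
  rw [cycSum_apply, cycSum_apply, ← Equiv.sum_comp (finRotate n)]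
  simp only [cycGlue_rotate_left]

theorem cycSum_rotate_right (a : O.obj (Fin n)) (b : O.obj (Fin m)) :
    O.cycSum n m a (O.map (finRotate m) b) = O.cycSum n m a b := by
  rw [cycSum_apply, cycSum_apply]
  refine Finset.sum_congr rfl fun s _ => ?_
  rw [← Equiv.sum_comp (finRotate m)]
  simp only [cycGlue_rotate_right]

/-- The bracket on the cyclic coinvariants. -/
noncomputable def cycBracket : O.CyclicCoinv →ₗ[k] O.CyclicCoinv →ₗ[k] O.CyclicCoinv :=
  -- The sign (-1)^|a| enters as a linear operator, so that the formula is bilinear on inhomogeneous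
  -- elements too.
  O.coinvLift₂ (fun n m => O.cycSum n m ∘ₗ O.scale (Fin n) (parityScalar k))
    (fun n m σ hσ a b => by
      rw [LinearMap.comp_apply, scale_map, LinearMap.comp_apply]
      exact O.cyclic_invariant ((O.cycSum n m).flip b)
        (fun a => O.cycSum_rotate_left a b) σ hσ _)
    (fun n m σ hσ a b => O.cyclic_invariant (O.cycSum n m _)
        (fun b => O.cycSum_rotate_right _ b) σ hσ b)

theorem cycBracket_cls {γ d : ℤ} {a : O.obj (Fin n)} (ha : a ∈ O.gr (Fin n) γ d)
    (b : O.obj (Fin m)) :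
    O.cycBracket (O.cls cyclicGroups n a) (O.cls cyclicGroups m b) =
      d.negOnePow • ∑ s, ∑ t, O.cycGlue s t a b := by
  rw [cycBracket, coinvLift₂_cls, LinearMap.comp_apply, O.scale_of_mem _ ha, map_smul,
    LinearMap.smul_apply, parityScalar_smul, cycSum_apply]

theorem isCyclicGluingBracket_cycBracket : O.IsCyclicGluingBracket O.cycBracket := by
  intro n m γ d a b ha
  simp only [cls_map_glue, O.cycBracket_cls ha]

theorem cycGlue_mem (s : Fin n) (t : Fin m) {γ d γ' d' : ℤ} {a : O.obj (Fin n)}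
    {b : O.obj (Fin m)} (ha : a ∈ O.gr (Fin n) γ d) (hb : b ∈ O.gr (Fin m) γ' d') :
    O.cycGlue s t a b ∈ O.degPart cyclicGroups (d + d' + w) :=
  O.cls_mem_degPart (O.contr_mem _ (O.hmul_mem ha hb))

end cyclic

end NCKModularOperad

/-! ### Trees with three vertices and the Jacobi identity. -/

namespace NCKModularOperad

variable {k : Type u} [Field k] {w : ℤˣ} (O : NCKModularOperad.{u, v} k w)

/-- Each flag survives both contractions, or is contracted second by `ψ` and first by `φ'`, or first
by `φ` and second by `ψ'`. This form of `contr_contr` suits a case analysis over concrete flags. -/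
theorem contr_contr_of_forall {S T U S' T' U' : Type} [Finite S] [Finite T] [Finite U] [Finite S']
    [Finite T'] [Finite U'] (f : S ≃ S') (g : U ≃ U')
    (φ : S ≃ T ⊕ (Unit × Bool)) (ψ : T ≃ U ⊕ (Unit × Bool))
    (φ' : S' ≃ T' ⊕ (Unit × Bool)) (ψ' : T' ≃ U' ⊕ (Unit × Bool))
    (h : ∀ x,
      (∃ t r t', φ x = Sum.inl t ∧ ψ t = Sum.inl r ∧ φ' (f x) = Sum.inl t' ∧ ψ' t' = Sum.inl (g r)) ∨
      (∃ t p p', φ x = Sum.inl t ∧ ψ t = Sum.inr p ∧ φ' (f x) = Sum.inr p') ∨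
      (∃ p t' p', φ x = Sum.inr p ∧ φ' (f x) = Sum.inl t' ∧ ψ' t' = Sum.inr p'))
    (a : O.obj S) :
    O.contr ψ' (O.contr φ' (O.map f a)) = -O.map g (O.contr ψ (O.contr φ a)) := by
  apply O.contr_contr
  · intro x t r h1 h2
    rcases h x with ⟨t₀, r₀, t', h3, h4, h5⟩ | ⟨t₀, p, p', h3, h4, h5⟩ | ⟨p, t', p', h3, h4, h5⟩
    · cases h3.symm.trans h1
      cases h4.symm.trans h2
      exact ⟨t', h5⟩
    · cases h3.symm.trans h1
      cases h4.symm.trans h2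
    · cases h3.symm.trans h1
  · intro x t p h1 h2
    rcases h x with ⟨t₀, r₀, t', h3, h4, h5⟩ | ⟨t₀, p, p', h3, h4, h5⟩ | ⟨p, t', p', h3, h4, h5⟩
    · cases h3.symm.trans h1
      cases h4.symm.trans h2
    · exact ⟨p', h5⟩
    · cases h3.symm.trans h1
  · intro x p h1
    rcases h x with ⟨t₀, r₀, t', h3, h4, h5⟩ | ⟨t₀, p, p', h3, h4, h5⟩ | ⟨p, t', p', h3, h4, h5⟩
    · cases h3.symm.trans h1
    · cases h3.symm.trans h1
    · exact ⟨t', p', h4, h5⟩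

section cyclic

variable {n m l : ℕ}

/-- The gluing of `a` at `s` to the flag `t'` of `b` in the gluing of `b` at `t` to `c` at `u`. -/
noncomputable def glueFirst (s : Fin n) (t' : Fin m) (u : Fin l) (t : Fin m) (a : O.obj (Fin n))
    (b : O.obj (Fin m)) (c : O.obj (Fin l)) : O.CyclicCoinv :=
  if h : t' ≠ t then O.cycGlue s (cyclicSumEnum t u (Sum.inl ⟨t', h⟩)) a
    (O.contr (cycPair t u) (O.hmulₗ b c)) else 0

/-- The gluing of `c` at `u` to the flag `t` of `b` in the gluing of `a` at `s` to `b` at `t'`. -/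
noncomputable def glueSecond (s : Fin n) (t' : Fin m) (u : Fin l) (t : Fin m) (a : O.obj (Fin n))
    (b : O.obj (Fin m)) (c : O.obj (Fin l)) : O.CyclicCoinv :=
  if h : t ≠ t' then O.cycGlue u (cyclicSumEnum s t' (Sum.inr ⟨t, h⟩)) c
    (O.contr (cycPair s t') (O.hmulₗ a b)) else 0

/-- The two orders in which the tree `a - b - c` can be glued. -/
theorem contr_contr_tree (s : Fin n) (t' : Fin m) (u : Fin l) (t : Fin m) (h : t' ≠ t)
    (x : O.obj (Fin n ⊕ (Fin m ⊕ Fin l))) :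
    O.cls cyclicGroups _ (O.contr (cycPair u (cyclicSumEnum s t' (Sum.inr ⟨t, h.symm⟩)))
      (O.contr (extendLeft (Fin l) (cycPair s t'))
        (O.map ((Equiv.sumAssoc _ _ _).symm.trans (Equiv.sumComm _ _)) x))) =
    -O.cls cyclicGroups _ (O.contr (cycPair s (cyclicSumEnum t u (Sum.inl ⟨t', h⟩)))
      (O.contr (extendLeft (Fin n) (cycPair t u)) x)) := by
  have hs := s.isLt
  have ht := t.isLt
  have ht' := t'.isLt
  have hu := u.isLt
  have htt : t'.val ≠ t.val := fun e => h (Fin.ext e)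
  -- Both sides are n + m + l - 4; the truncated subtractions are harmless because `t' ≠ t` forces
  -- `m` to be at least 2.
  have hN : n - 1 + (m - 1 + (l - 1) - 1) = l - 1 + (n - 1 + (m - 1) - 1) := by omega
  have hv := cyclicEnum_cases h
  have hv' := cyclicEnum_cases h.symm
  rw [O.contr_contr_of_forall _
    -- Let A and C be the free flags of the outer vertices, B₁ those of the middle one from `t'` to
    -- `t`, and B₂ those from `t` to `t'`. Gluing b to c first gives the word A B₁ C B₂, gluing a to
    -- b first gives C B₂ A B₁. The shift is |C| + |B₂|, and |B₂| is `m` - 2 minus the position of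
    -- `t` after `t'`.
    (rotateEquiv hN (l - 1 + (m - 1) - 1 - (cyclicEnum t' ⟨t, h.symm⟩).val))
    (extendLeft (Fin n) (cycPair t u)) (cycPair s (cyclicSumEnum t u (Sum.inl ⟨t', h⟩))),
    map_neg, cls_rotateEquiv]
  rintro (x | y | z)
  · by_cases hx : x = s
    · subst hx
      exact Or.inr (Or.inl ⟨_, _, _, extendLeft_inl _ _, cycPair_inl_self _ _,
        extendLeft_inr_inr (cycPair_inl_self _ _)⟩)
    · have hne : Fin.castAdd (m - 1) (cyclicEnum s ⟨x, hx⟩) ≠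
          cyclicSumEnum s t' (Sum.inr ⟨t, h.symm⟩) := fun e =>
        Sum.inl_ne_inr ((cyclicSumEnum s t').injective e)
      refine Or.inl ⟨_, _, _, extendLeft_inl _ _, cycPair_inl _ _ hx,
        extendLeft_inr_inl (cycPair_inl _ _ hx), (cycPair_inr _ _ hne).trans
          (congrArg Sum.inl (rotateEquiv_eq _ _ _ _ ?_))⟩
      have hx0 := (cyclicEnum s ⟨x, hx⟩).isLt
      have hq := cyclicEnum_cases hne
      simp only [Fin.val_castAdd, Fin.val_natAdd, cyclicSumEnum_inr_val] at hq ⊢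
      omega
  · by_cases hy : y = t
    · subst hy
      exact Or.inr (Or.inr ⟨_, _, _, extendLeft_inr_inr (cycPair_inl_self _ _),
        extendLeft_inr_inl (cycPair_inr _ _ h.symm), cycPair_inr_self _ _⟩)
    by_cases hy' : y = t'
    · subst hy'
      exact Or.inr (Or.inl ⟨_, _, _, extendLeft_inr_inl (cycPair_inl _ _ hy),
        cycPair_inr_self _ _, extendLeft_inr_inr (cycPair_inr_self _ _)⟩)
    have hne : Fin.castAdd (l - 1) (cyclicEnum t ⟨y, hy⟩) ≠
        cyclicSumEnum t u (Sum.inl ⟨t', h⟩) := fun e =>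
      hy' (congrArg Subtype.val (Sum.inl_injective ((cyclicSumEnum t u).injective e)))
    have hne' : Fin.natAdd (n - 1) (cyclicEnum t' ⟨y, hy'⟩) ≠
        cyclicSumEnum s t' (Sum.inr ⟨t, h.symm⟩) := fun e =>
      hy (congrArg Subtype.val (Sum.inr_injective ((cyclicSumEnum s t').injective e)))
    refine Or.inl ⟨_, _, _, extendLeft_inr_inl (cycPair_inl _ _ hy), cycPair_inr _ _ hne,
      extendLeft_inr_inl (cycPair_inr _ _ hy'), (cycPair_inr _ _ hne').trans
        (congrArg Sum.inl (rotateEquiv_eq _ _ _ _ ?_))⟩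
    have hy0 := y.isLt
    have hp := cyclicEnum_cases hy
    have hp' := cyclicEnum_cases hy'
    have hq := cyclicEnum_cases hne
    have hq' := cyclicEnum_cases hne'
    simp only [Fin.val_castAdd, Fin.val_natAdd, cyclicSumEnum_inl_val, cyclicSumEnum_inr_val]
      at hq hq' ⊢
    omega
  · by_cases hz : z = u
    · subst hz
      exact Or.inr (Or.inr ⟨_, _, _, extendLeft_inr_inr (cycPair_inr_self _ _),
        extendLeft_inl _ _, cycPair_inl_self _ _⟩)
    · have hne : Fin.natAdd (m - 1) (cyclicEnum u ⟨z, hz⟩) ≠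
          cyclicSumEnum t u (Sum.inl ⟨t', h⟩) := fun e =>
        Sum.inr_ne_inl ((cyclicSumEnum t u).injective e)
      refine Or.inl ⟨_, _, _, extendLeft_inr_inl (cycPair_inr _ _ hz), cycPair_inr _ _ hne,
        extendLeft_inl _ _, (cycPair_inl _ _ hz).trans
          (congrArg Sum.inl (rotateEquiv_eq _ _ _ _ ?_))⟩
      have hz0 := (cyclicEnum u ⟨z, hz⟩).isLt
      have hq := cyclicEnum_cases hne
      simp only [Fin.val_castAdd, Fin.val_natAdd, cyclicSumEnum_inl_val] at hq ⊢
      omega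

/-- The exponents `r` and `i` come from pulling the inner edge in front of `c` and of `a`, `r * (i +
j)` from moving `c` past a ⊟ b, and the minus sign from exchanging the two edges. -/
theorem glueSecond_eq (s : Fin n) (t' : Fin m) (u : Fin l) (t : Fin m) {γ i γ' j γ'' r : ℤ}
    {a : O.obj (Fin n)} {b : O.obj (Fin m)} {c : O.obj (Fin l)} (ha : a ∈ O.gr (Fin n) γ i)
    (hb : b ∈ O.gr (Fin m) γ' j) (hc : c ∈ O.gr (Fin l) γ'' r) :
    O.glueSecond s t' u t a b c =
      -((r + i + r * (i + j)).negOnePow • O.glueFirst s t' u t a b c) := by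
  by_cases h : t' = t
  · subst h
    simp [glueFirst, glueSecond]
  rw [glueFirst, dif_pos h, glueSecond, dif_pos (Ne.symm h), cycGlue_apply, cycGlue_apply,
    O.hmul_contr_right _ hc, O.hmul_contr_right _ ha, O.hmul_comm (O.hmul_mem ha hb) hc]
  have h1 : O.hmulₗ (O.hmulₗ a b) c = O.map (Equiv.sumAssoc _ _ _).symm
      (O.hmulₗ a (O.hmulₗ b c)) := by
    rw [hmul_assoc, ← O.map_trans, Equiv.self_trans_symm, O.map_refl]
  rw [h1, ← O.map_trans]
  simp only [map_sign_smul]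
  rw [O.contr_contr_tree s t' u t h, smul_neg, smul_neg, smul_smul, smul_smul,
    ← Int.negOnePow_add, ← Int.negOnePow_add]
  congr 2
  rw [Int.negOnePow_eq_iff]
  exact ⟨-i, by ring⟩

/-- One half of the sum over the trees with three vertices. -/
noncomputable def sumFirst (a : O.obj (Fin n)) (b : O.obj (Fin m)) (c : O.obj (Fin l)) :
    O.CyclicCoinv :=
  ∑ s, ∑ t', ∑ u, ∑ t, O.glueFirst s t' u t a b c

/-- The other half of the sum over the trees with three vertices. -/
noncomputable def sumSecond (a : O.obj (Fin n)) (b : O.obj (Fin m)) (c : O.obj (Fin l)) :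
    O.CyclicCoinv :=
  ∑ s, ∑ t', ∑ u, ∑ t, O.glueSecond s t' u t a b c

theorem sumSecond_eq {γ i γ' j γ'' r : ℤ}
    {a : O.obj (Fin n)} {b : O.obj (Fin m)} {c : O.obj (Fin l)} (ha : a ∈ O.gr (Fin n) γ i)
    (hb : b ∈ O.gr (Fin m) γ' j) (hc : c ∈ O.gr (Fin l) γ'' r) :
    O.sumSecond a b c = -((r + i + r * (i + j)).negOnePow • O.sumFirst a b c) := by
  simp only [sumFirst, sumSecond, O.glueSecond_eq _ _ _ _ ha hb hc, Finset.sum_neg_distrib,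
    Finset.smul_sum]

/-- The flag of the inner gluing that receives `a` belongs to `b` or to `c`. In the second case the
tree is read as b - c - a, with its first two vertices glued first. -/
theorem cycBracket_cycBracket {γ i γ' j : ℤ}
    {a : O.obj (Fin n)} {b : O.obj (Fin m)} {c : O.obj (Fin l)} (ha : a ∈ O.gr (Fin n) γ i)
    (hb : b ∈ O.gr (Fin m) γ' j) :
    O.cycBracket (O.cls cyclicGroups n a)
        (O.cycBracket (O.cls cyclicGroups m b) (O.cls cyclicGroups l c)) =
      (i + j).negOnePow • (O.sumFirst a b c + O.sumSecond b c a) := by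
  rw [O.cycBracket_cls hb, map_sign_smul, map_sum]
  simp only [map_sum, cycGlue_apply, O.cycBracket_cls ha]
  simp only [← Finset.smul_sum]
  rw [smul_smul, ← Int.negOnePow_add, add_comm j i]
  congr 1
  have h : ∀ (t : Fin m) (u : Fin l) (s : Fin n),
      ∑ v, O.cls cyclicGroups _ (O.contr (cycPair s v)
        (O.hmulₗ a (O.contr (cycPair t u) (O.hmulₗ b c)))) =
      ∑ t', O.glueFirst s t' u t a b c + ∑ u', O.glueSecond t u s u' b c a := by
    intro t u s
    -- Split the free flags by the vertex they belong to. The value zero at the flag already used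
    -- agrees with the conventions in `glueFirst` and `glueSecond`.
    rw [← Equiv.sum_comp (cyclicSumEnum t u), Fintype.sum_sum_type,
      Fintype.sum_subtype_eq_sum_dite, Fintype.sum_subtype_eq_sum_dite]
    rfl
  simp only [h, Finset.sum_add_distrib]
  congr 1
  exact Finset.sum_rearrange fun s t' u t => O.glueFirst s t' u t a b c

end cyclic

theorem isOddLie_cycBracket : IsOddLie (O.degPart cyclicGroups) w O.cycBracket where
  isInternal := O.degPart_isInternal cyclicGroups
  degree i j x y hx hy := by
    refine O.degPart_induction
      (p := fun x => O.cycBracket x y ∈ O.degPart cyclicGroups (i + j + w)) (fun n γ a ha => ?_)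
      (fun x x' h h' => by rw [map_add]; exact add_mem h h') hx
    refine O.degPart_induction
      (p := fun y => O.cycBracket _ y ∈ O.degPart cyclicGroups (i + j + w)) (fun m γ' b hb => ?_)
      (fun x x' h h' => by rw [map_add]; exact add_mem h h') hy
    rw [O.cycBracket_cls ha, Units.smul_def]
    exact zsmul_mem (sum_mem fun s _ => sum_mem fun t _ => O.cycGlue_mem s t ha hb) _
  antisymm i j x y hx hy := by
    refine O.degPart_induction (p := fun x => O.cycBracket x y =
      -(((i + 1) * (j + 1)).negOnePow • O.cycBracket y x)) (fun n γ a ha => ?_)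
      (fun x x' h h' => by
        simp only [map_add, LinearMap.add_apply, h, h', smul_add, neg_add]) hx
    refine O.degPart_induction (p := fun y => O.cycBracket _ y =
      -(((i + 1) * (j + 1)).negOnePow • O.cycBracket y _)) (fun m γ' b hb => ?_)
      (fun x x' h h' => by
        simp only [map_add, LinearMap.add_apply, h, h', smul_add, neg_add]) hy
    rw [O.cycBracket_cls ha, O.cycBracket_cls hb, Finset.sum_comm]
    simp only [O.cycGlue_comm _ _ hb ha]
    simp only [← Finset.smul_sum]
    rw [smul_smul, smul_smul, ← Int.negOnePow_add, ← Int.negOnePow_add, ← Units.neg_smul,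
      ← Int.negOnePow_succ]
    congr 1
    rw [Int.negOnePow_eq_iff]
    exact ⟨-j - 1, by ring⟩
  jacobi i j r x y z hx hy hz := by
    refine O.degPart_induction (p := fun x => O.cycBracket x (O.cycBracket y z)
      + ((r + 1) * ((i + 1) + (j + 1))).negOnePow • O.cycBracket z (O.cycBracket x y)
      + ((i + 1) * ((j + 1) + (r + 1))).negOnePow • O.cycBracket y (O.cycBracket z x) = 0)
      (fun n γ a ha => ?_) (fun x x' h h' => by
        simp only [map_add, LinearMap.add_apply, smul_add]
        rw [← add_zero (0 : O.CyclicCoinv)]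
        nth_rewrite 1 [← h]
        rw [← h']
        abel) hx
    refine O.degPart_induction (p := fun y => O.cycBracket _ (O.cycBracket y z)
      + ((r + 1) * ((i + 1) + (j + 1))).negOnePow • O.cycBracket z (O.cycBracket _ y)
      + ((i + 1) * ((j + 1) + (r + 1))).negOnePow • O.cycBracket y (O.cycBracket z _) = 0)
      (fun m γ' b hb => ?_) (fun x x' h h' => by
        simp only [map_add, LinearMap.add_apply, smul_add]
        rw [← add_zero (0 : O.CyclicCoinv)]
        nth_rewrite 1 [← h]
        rw [← h']
        abel) hy
    refine O.degPart_induction (p := fun z => O.cycBracket _ (O.cycBracket _ z)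
      + ((r + 1) * ((i + 1) + (j + 1))).negOnePow • O.cycBracket z (O.cycBracket _ _)
      + ((i + 1) * ((j + 1) + (r + 1))).negOnePow • O.cycBracket _ (O.cycBracket z _) = 0)
      (fun l γ'' c hc => ?_) (fun x x' h h' => by
        simp only [map_add, LinearMap.add_apply, smul_add]
        rw [← add_zero (0 : O.CyclicCoinv)]
        nth_rewrite 1 [← h]
        rw [← h']
        abel) hz
    -- Six half-sums appear; `sumSecond_eq` expresses them through three, one for each choice of the
    -- middle vertex.
    rw [O.cycBracket_cycBracket ha hb, O.cycBracket_cycBracket hc ha,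
      O.cycBracket_cycBracket hb hc, O.sumSecond_eq ha hb hc, O.sumSecond_eq hb hc ha,
      O.sumSecond_eq hc ha hb]
    simp only [smul_add, smul_neg, smul_smul, ← Int.negOnePow_add]
    generalize O.sumFirst a b c = X
    generalize O.sumFirst b c a = Y
    generalize O.sumFirst c a b = Z
    -- Each of `X`, `Y`, `Z` occurs twice, once with an explicit minus; the three parity identities
    -- make the two coefficients cancel.
    have e1 : ((r + 1) * (i + 1 + (j + 1)) + (r + i + (r + i + r * (i + j)))).negOnePow =
        (i + j).negOnePow := by
      rw [Int.negOnePow_eq_iff]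
      exact ⟨r * (i + j) + 2 * r + i + 1, by ring⟩
    have e2 : (i + j + (i + j + i * (j + r))).negOnePow =
        ((i + 1) * (j + 1 + (r + 1)) + (j + r)).negOnePow := by
      rw [Int.negOnePow_eq_iff]
      exact ⟨-r - 1, by ring⟩
    have e3 : ((i + 1) * (j + 1 + (r + 1)) + (j + r + (j + r + j * (r + i)))).negOnePow =
        ((r + 1) * (i + 1 + (j + 1)) + (r + i)).negOnePow := by
      rw [Int.negOnePow_eq_iff]
      exact ⟨i * j + j, by ring⟩
    rw [e1, e2, e3]
    abel

end NCKModularOperad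

namespace NCKModularOperad

variable {k : Type u} [Field k] {w : ℤˣ} (O : NCKModularOperad.{u, v} k w)

/-! ### From the cyclic to the full coinvariants -/

/-- The projection of the cyclic onto the full coinvariants. -/
noncomputable def cycToFull : O.CyclicCoinv →ₗ[k] O.FullCoinv :=
  O.coinvLift (fun n => O.fullCls (Fin n)) fun _ σ _ a => O.fullCls_map σ a

theorem cycToFull_cls {n : ℕ} (a : O.obj (Fin n)) :
    O.cycToFull (O.cls cyclicGroups n a) = O.fullCls (Fin n) a :=
  O.coinvLift_cls _ _ n a

/-- Lifting within a fixed degree lets the graded identities, signs included, be pulled back to the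
cyclic coinvariants. -/
theorem exists_cycToFull_eq {d : ℤ} {x : O.FullCoinv} (hx : x ∈ O.degPart fullGroups d) :
    ∃ y ∈ O.degPart cyclicGroups d, O.cycToFull y = x :=
  O.full_degPart_induction (p := fun x => ∃ y ∈ O.degPart cyclicGroups d, O.cycToFull y = x)
    (fun n _ a ha => ⟨O.cls cyclicGroups n a, O.cls_mem_degPart ha, O.cycToFull_cls a⟩)
    (fun _ _ ⟨y, hy, e⟩ ⟨y', hy', e'⟩ => ⟨y + y', add_mem hy hy', by rw [map_add, e, e']⟩) hx

theorem cycToFull_mem {d : ℤ} {x : O.CyclicCoinv} (hx : x ∈ O.degPart cyclicGroups d) :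
    O.cycToFull x ∈ O.degPart fullGroups d :=
  O.degPart_induction (p := fun x => O.cycToFull x ∈ O.degPart fullGroups d)
    (fun n _ a ha => by rw [cycToFull_cls]; exact O.fullCls_mem_degPart ha)
    (fun _ _ h h' => by rw [map_add]; exact add_mem h h') hx

/-- Both brackets sum over the same pairs of flags, and the cyclic enumeration of the result is
forgotten by `fullCls_contr`. -/
theorem cycToFull_bracket [CharZero k] (x y : O.CyclicCoinv) :
    O.cycToFull (O.cycBracket x y) = O.fullBracket (O.cycToFull x) (O.cycToFull y) := by
  induction x using O.coinv_induction with
  | add x x' h h' => simp only [map_add, LinearMap.add_apply, h, h']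
  | cls n a =>
  induction y using O.coinv_induction with
  | add y y' h h' => simp only [map_add, h, h']
  | cls m b =>
  induction a using O.obj_induction with
  | add a a' h h' => simp only [map_add, LinearMap.add_apply, h, h']
  | hom γ d a ha =>
    rw [O.cycBracket_cls ha, cycToFull_cls, cycToFull_cls, O.fullBracket_fullCls ha,
      map_sign_smul, map_sum]
    simp only [map_sum, cycGlue_apply, cycToFull_cls]
    congr 1
    refine Finset.sum_congr rfl fun s _ => Finset.sum_congr rfl fun t _ => ?_
    apply O.fullCls_contr _ Sum.inl_ne_inr
    · rw [cycPair_inl_self]; rfl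
    · rw [cycPair_inr_self]; rfl

/-- Each identity is the image of its cyclic counterpart under a surjection that respects the
brackets. -/
theorem isOddLie_fullBracket [CharZero k] :
    IsOddLie (O.degPart fullGroups) w O.fullBracket where
  isInternal := O.degPart_isInternal fullGroups
  degree i j x y hx hy := by
    obtain ⟨x, hx', rfl⟩ := O.exists_cycToFull_eq hx
    obtain ⟨y, hy', rfl⟩ := O.exists_cycToFull_eq hy
    rw [← cycToFull_bracket]
    exact O.cycToFull_mem (O.isOddLie_cycBracket.degree i j x y hx' hy')
  antisymm i j x y hx hy := by
    obtain ⟨x, hx', rfl⟩ := O.exists_cycToFull_eq hx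
    obtain ⟨y, hy', rfl⟩ := O.exists_cycToFull_eq hy
    rw [← cycToFull_bracket, O.isOddLie_cycBracket.antisymm i j x y hx' hy', map_neg, map_sign_smul,
      cycToFull_bracket]
  jacobi i j l x y z hx hy hz := by
    obtain ⟨x, hx', rfl⟩ := O.exists_cycToFull_eq hx
    obtain ⟨y, hy', rfl⟩ := O.exists_cycToFull_eq hy
    obtain ⟨z, hz', rfl⟩ := O.exists_cycToFull_eq hz
    have h := congrArg O.cycToFull (O.isOddLie_cycBracket.jacobi i j l x y z hx' hy' hz')
    simpa only [map_add, map_sign_smul, cycToFull_bracket, map_zero] using h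

theorem isGerstenhaber_fullBracket [CharZero k] :
    IsGerstenhaber (O.degPart fullGroups) w O.fullMul O.fullBracket where
  oddLie := O.isOddLie_fullBracket
  mul_degree _ _ _ _ hx hy := O.fullMul_mem hx hy
  mul_assoc := O.fullMul_assoc
  leibniz _ _ _ _ z hx hy := O.fullBracket_leibniz hx hy z

theorem isInducedBracket_fullBracket :
    IsInducedBracket (O.degPart fullGroups) O.fullMul O.fullDelta O.fullBracket :=
  fun _ _ y hx => O.fullBracket_of_mem hx y

theorem isBV_fullDelta [CharZero k] :
    IsBV (O.degPart fullGroups) w O.fullMul O.fullDelta where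
  mul_degree _ _ _ _ hx hy := O.fullMul_mem hx hy
  mul_assoc := O.fullMul_assoc
  mul_comm _ _ _ _ hx hy := O.fullMul_comm hx hy
  degree _ _ hx := O.fullDelta_mem hx
  sq_zero := O.fullDelta_sq
  gerstenhaber := ⟨O.fullBracket, O.isInducedBracket_fullBracket, O.isGerstenhaber_fullBracket⟩

end NCKModularOperad


theorem mainTheorem8 {k : Type u} [Field k] [CharZero k] {w : ℤˣ}
    (O : NCKModularOperad.{u, v} k w) :
    (∃ br : O.CyclicCoinv →ₗ[k] O.CyclicCoinv →ₗ[k] O.CyclicCoinv,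
      O.IsCyclicGluingBracket br ∧
      IsOddLie (O.degPart NCKModularOperad.cyclicGroups) w br) ∧
    ∃ (mul br : O.FullCoinv →ₗ[k] O.FullCoinv →ₗ[k] O.FullCoinv)
      (D : O.FullCoinv →ₗ[k] O.FullCoinv),
      O.IsHorizontalMul mul ∧
      O.IsFullGluingBracket br ∧
      O.IsSelfGluingOperator D ∧
      IsOddLie (O.degPart NCKModularOperad.fullGroups) w br ∧
      IsGerstenhaber (O.degPart NCKModularOperad.fullGroups) w mul br ∧
      IsBV (O.degPart NCKModularOperad.fullGroups) w mul D ∧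
      IsInducedBracket (O.degPart NCKModularOperad.fullGroups) mul D br := by
  exact ⟨⟨O.cycBracket, O.isCyclicGluingBracket_cycBracket, O.isOddLie_cycBracket⟩,
    O.fullMul, O.fullBracket, O.fullDelta, fun _ _ _ _ a b => O.fullMul_fullCls a b,
    O.isFullGluingBracket_fullBracket, O.isSelfGluingOperator_fullDelta, O.isOddLie_fullBracket,
    O.isGerstenhaber_fullBracket, O.isBV_fullDelta, O.isInducedBracket_fullBracket⟩
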